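/- For every $n\ge 1$ let $X_1,\dots,X_n$ be independent standard normal random variables (they may live on a different probability space for each $n$). For $\sigma\in\{-1,+1\}^n$ let $E(\sigma)=n^{-1/2}\bigl|\sum_{i=1}^n\sigma_iX_i\bigr|$; since $E(\sigma)=E(-\sigma)$, this is a function of the unordered partition $\{\sigma,-\sigma\}$. For $a\le b$ let $Z_n(a,b)$ be the number of the $2^{n-1}$ distinct partitions $\{\sigma,-\sigma\}$ with $E(\sigma)\in[a,b]$. Let $\alpha_n\ge 0$ be a sequence with $\alpha_n=o(\sqrt n)$, put $$\xi_n=\frac{1}{2^{n-1}g(\alpha_n)},\qquad g(y)=\sqrt{2/\pi}\,e^{-y^2/2},$$ where $g$ is the density of each $E(\sigma)$ on $[0,\infty)$, and for $t>0$ put $N_n(t)=Z_n(\alpha_n,\alpha_n+t\xi_n)$. Write $(Z)_k=Z(Z-1)\cdots(Z-k+1)$. (i) For every fixed $t>0$, $\mathbb E[N_n(t)]=t+o(1)$ as $n\to\infty$. (ii) Let $[c_1,d_1],\dots,[c_m,d_m]$ be finitely many intervals with $0\le c_\ell<d_\ell$ and pairwise disjoint interiors, let $k_1,\dots,k_m$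 be positive integers with $k=\sum_\ell k_\ell\ge 2$, and set $\gamma_\ell=d_\ell-c_\ell$, $a_n^\ell=\alpha_n+c_\ell\xi_n$, $b_n^\ell=\alpha_n+d_\ell\xi_n$. Then there are real sequences $u_n=O(\alpha_n^6n^{-2})$ and $v_n=o(1)$ such that for all sufficiently large $n$ $$\mathbb E\Bigl[\prod_{\ell=1}^m\bigl(Z_n(a_n^\ell,b_n^\ell)\bigr)_{k_\ell}\Bigr]=\Bigl(\prod_{\ell=1}^m\gamma_\ell^{k_\ell}\Bigr)\,e^{\frac{k(k-1)}{4n}\alpha_n^4}\,e^{u_n+v_n}.$$ (iii) In particular, factorization fails once $\alpha_n$ is at least of order $n^{1/4}$: if $n^{1/4}=O(\alpha_n)$, then for all intervals and integers as in (ii) there is $\delta>0$ such that for all sufficiently large $n$ the expectation on the left-hand side in (ii) is at least $(1+\delta)\prod_\ell\gamma_\ell^{k_\ell}$ and also at least $(1+\delta)\prod_\ell\bigl(\mathbb E[Z_n(a_n^\ell,b_n^\ell)]\bigr)^{k_\ell}$. -/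

import Mathlib

open MeasureTheory ProbabilityTheory Filter Asymptotics
open scoped NNReal ENNReal Topology

namespace NumberPartitioning

/-- Spin configurations `σ ∈ {-1, +1}ⁿ`. -/
abbrev Spin (n : ℕ) : Type := Fin n → ℤˣ

/-- The energy `E(σ) = n^{-1/2} |∑ᵢ σᵢ xᵢ|` of a configuration for the weights `x₁, …, xₙ`. -/
noncomputable def energy {n : ℕ} (x : Fin n → ℝ) (σ : Spin n) : ℝ :=
  |∑ i, (((σ i : ℤˣ) : ℤ) : ℝ) * x i| / √(n : ℝ)

/-- Two configurations describe the same (unordered) partition iff they agree up to a global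
spin flip. -/
def flipSetoid (n : ℕ) : Setoid (Spin n) where
  r σ τ := τ = σ ∨ τ = -σ
  iseqv :=
    { refl := fun _ => Or.inl rfl
      symm := by
        rintro σ τ (rfl | rfl)
        · exact Or.inl rfl
        · exact Or.inr (neg_neg σ).symm
      trans := by
        rintro σ τ υ (rfl | rfl) (rfl | rfl)
        · exact Or.inl rfl
        · exact Or.inr rfl
        · exact Or.inr rfl
        · exact Or.inl (neg_neg σ) }

/-- The distinct partitions of `{1, …, n}` into two sets; there are `2^{n-1}` of them
for `n ≥ 1`. -/
abbrev Partition (n : ℕ) : Type := Quotient (flipSetoid n)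

lemma energy_neg {n : ℕ} (x : Fin n → ℝ) (σ : Spin n) : energy x (-σ) = energy x σ := by
  simp [energy, Finset.sum_neg_distrib, abs_neg]

/-- The energy of a partition. -/
noncomputable def Partition.energy {n : ℕ} (x : Fin n → ℝ) (p : Partition n) : ℝ :=
  Quotient.lift (NumberPartitioning.energy x)
    (by
      rintro σ τ (rfl | rfl)
      · rfl
      · exact (energy_neg x σ).symm) p

/-- `Z_n(a, b)`: the number of points of the energy spectrum (the energies of the `2^{n-1}`
distinct partitions, with multiplicity) in the interval `[a, b]`. -/
noncomputable def numPoints {n : ℕ} (x : Fin n → ℝ) (a b : ℝ) : ℕ :=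
  Set.ncard {p : Partition n | Partition.energy x p ∈ Set.Icc a b}

/-- The density `g(y) = √(2/π) e^{-y²/2}` on `[0, ∞)` of the energy `E(σ)` for standard normal
weights; that this is the density is proved in `map_energy_eq_withDensity`. -/
noncomputable def energyDensity (y : ℝ) : ℝ :=
  √(2 / Real.pi) * Real.exp (-y ^ 2 / 2)

/-- The scaling factor `ξ_n = 1 / (2^{n-1} g(α))` at the energy scale `α` (for `n ≥ 1`). -/
noncomputable def scaling (n : ℕ) (α : ℝ) : ℝ :=
  1 / ((2 : ℝ) ^ (n - 1) * energyDensity α)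

section Density

variable {Ω : Type*} [MeasurableSpace Ω] {P : Measure Ω}

lemma map_abs_gaussian {H : Ω → ℝ} (hH : HasLaw H (gaussianReal 0 1) P) :
    P.map (fun ω => |H ω|) =
      (volume.restrict (Set.Ici (0 : ℝ))).withDensity
        (fun y => ENNReal.ofReal (energyDensity y)) := by
  have h1 : P.map (fun ω => |H ω|) = (gaussianReal 0 1).map (fun x : ℝ => |x|) := by
    rw [← hH.map_eq, AEMeasurable.map_map_of_aemeasurable (by fun_prop) hH.aemeasurable]
    rfl
  have hpdf : ∀ x : ℝ, gaussianPDF 0 1 |x| = gaussianPDF 0 1 x := by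
    intro x
    simp [gaussianPDF, gaussianPDFReal]
  have hdens : ∀ y : ℝ, ENNReal.ofReal (energyDensity y) = 2 * gaussianPDF 0 1 y := by
    intro y
    rw [gaussianPDF, show (2 : ℝ≥0∞) = ENNReal.ofReal 2 by simp,
      ← ENNReal.ofReal_mul (by norm_num)]
    congr 1
    simp only [energyDensity, gaussianPDFReal, NNReal.coe_one, mul_one, sub_zero]
    rw [← mul_assoc]
    congr 1
    have hpi := Real.pi_pos
    rw [← Real.sqrt_inv, show (2 / Real.pi : ℝ) = 2 ^ 2 * (2 * Real.pi)⁻¹ by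
      field_simp, Real.sqrt_mul (by positivity), Real.sqrt_sq (by norm_num)]
  have hf : Measurable (fun y : ℝ => ENNReal.ofReal (energyDensity y)) := by
    simp_rw [hdens]
    exact (measurable_gaussianPDF 0 1).const_mul 2
  rw [h1]
  ext s hs
  rw [Measure.map_apply (by fun_prop) hs, withDensity_apply _ hs,
    gaussianReal_apply _ one_ne_zero, Measure.restrict_restrict hs]
  have hA : MeasurableSet ((fun x : ℝ => |x|) ⁻¹' s) := by
    exact (by fun_prop : Measurable fun x : ℝ => |x|) hs
  have hcov : (∫⁻ x in ((fun x : ℝ => |x|) ⁻¹' s) ∩ Set.Iio 0, gaussianPDF 0 1 x)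
      = ∫⁻ x in s ∩ Set.Ioi 0, gaussianPDF 0 1 x := by
    have hmp : MeasurePreserving (fun x : ℝ => -x) volume volume := Measure.measurePreserving_neg _
    have hme : MeasurableEmbedding (fun x : ℝ => -x) := (MeasurableEquiv.neg ℝ).measurableEmbedding
    rw [← hmp.setLIntegral_comp_preimage_emb hme]
    have hset : (fun x : ℝ => -x) ⁻¹' (((fun x : ℝ => |x|) ⁻¹' s) ∩ Set.Iio 0)
        = s ∩ Set.Ioi 0 := by
      ext x
      simp only [Set.mem_preimage, Set.mem_inter_iff, abs_neg, Set.mem_Iio, Set.mem_Ioi,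
        neg_lt_zero]
      refine ⟨fun h => ⟨?_, h.2⟩, fun h => ⟨?_, h.2⟩⟩
      · simpa [abs_of_pos h.2] using h.1
      · simpa [abs_of_pos h.2] using h.1
    rw [hset]
    refine lintegral_congr fun x => ?_
    rw [← hpdf (-x), abs_neg, hpdf]
  have hpos : ((fun x : ℝ => |x|) ⁻¹' s) \ Set.Iio 0 = s ∩ Set.Ici 0 := by
    ext x
    simp only [Set.mem_preimage, Set.mem_sdiff, Set.mem_inter_iff, Set.mem_Iio, Set.mem_Ici, not_lt]
    refine ⟨fun h => ⟨?_, h.2⟩, fun h => ⟨?_, h.2⟩⟩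
    · simpa [abs_of_nonneg h.2] using h.1
    · simpa [abs_of_nonneg h.2] using h.1
  have hae : (s ∩ Set.Ioi (0 : ℝ) : Set ℝ) =ᵐ[volume] (s ∩ Set.Ici (0 : ℝ) : Set ℝ) :=
    (ae_eq_refl s).inter Ioi_ae_eq_Ici
  rw [← lintegral_inter_add_sdiff _ _ (measurableSet_Iio (a := (0 : ℝ))), hcov, hpos,
    setLIntegral_congr hae]
  simp_rw [hdens]
  rw [lintegral_const_mul _ (measurable_gaussianPDF 0 1), two_mul]

/-- For independent standard normal weights and `n ≥ 1`, every energy `E(σ)` has density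
`energyDensity` with respect to Lebesgue measure on `[0, ∞)`. -/
theorem map_energy_eq_withDensity {n : ℕ} (hn : 0 < n)
    {X : Fin n → Ω → ℝ} (hind : iIndepFun X P)
    (hlaw : ∀ i, HasLaw (X i) (gaussianReal 0 1) P) (σ : Spin n) :
    P.map (fun ω => energy (fun i => X i ω) σ) =
      (volume.restrict (Set.Ici (0 : ℝ))).withDensity
        (fun y => ENNReal.ofReal (energyDensity y)) := by
  have hprob : IsProbabilityMeasure P := hind.isProbabilityMeasure
  let Y : Fin n → Ω → ℝ := fun i ω => (((σ i : ℤˣ) : ℤ) : ℝ) * X i ω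
  have hYlaw : ∀ i, HasLaw (Y i) (gaussianReal 0 1) P := by
    intro i
    have h := gaussianReal_const_mul (hlaw i) (((σ i : ℤˣ) : ℤ) : ℝ)
    have hv : (NNReal.mk ((((σ i : ℤˣ) : ℤ) : ℝ) ^ 2) (sq_nonneg _) * 1 : ℝ≥0) = 1 := by
      rcases Int.units_eq_one_or (σ i) with h' | h' <;> ext <;> simp [h']
    rwa [hv, mul_zero] at h
  have hYind : iIndepFun Y P :=
    hind.comp (fun i x => (((σ i : ℤˣ) : ℤ) : ℝ) * x) (fun i => by fun_prop)
  have key : ∀ s : Finset (Fin n),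
      HasLaw (∑ i ∈ s, Y i) (gaussianReal 0 (s.card : ℝ≥0)) P := by
    intro s
    induction s using Finset.induction_on with
    | empty =>
      refine ⟨by simp; fun_prop, ?_⟩
      simp only [Finset.sum_empty, Finset.card_empty, Nat.cast_zero, gaussianReal_zero_var]
      rw [show (0 : Ω → ℝ) = fun _ => (0 : ℝ) from rfl, Measure.map_const]
      simp
    | insert i s hi ih =>
      rw [Finset.sum_insert hi, add_comm]
      refine ⟨ih.aemeasurable.add (hYlaw i).aemeasurable, ?_⟩
      rw [gaussianReal_add_gaussianReal_of_indepFun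
        (hYind.indepFun_finsetSum_of_notMem₀ (fun j => (hYlaw j).aemeasurable) hi)
        ih.map_eq (hYlaw i).map_eq, Finset.card_insert_of_notMem hi]
      simp
  have hH : HasLaw (fun ω => (∑ i, Y i) ω / √(n : ℝ)) (gaussianReal 0 1) P := by
    have h := gaussianReal_div_const (key Finset.univ) (√(n : ℝ))
    have hn' : (0 : ℝ) < n := by exact_mod_cast hn
    have hv : (((Finset.univ : Finset (Fin n)).card : ℝ≥0) /
        NNReal.mk (√(n : ℝ) ^ 2) (sq_nonneg _) : ℝ≥0) = 1 := by
      ext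
      simp [hn'.ne']
    rwa [hv, zero_div] at h
  rw [← map_abs_gaussian hH]
  congr 1
  funext ω
  simp [energy, Y, abs_div, abs_of_nonneg (Real.sqrt_nonneg _)]

end Density

end NumberPartitioning

/-!
The signed energies of `k` linearly independent sign vectors form a centred Gaussian vector whose
covariance is the overlap matrix `Q`, so the probability that all of them lie in windows of width
of order `ξ` near `α` is the value of its density at `(α, …, α)` times the volume of the window.
Every factorial moment is the sum of these probabilities over `k`-tuples of sign vectors.

For nearly orthogonal tuples `det Q` is close to one, and expanding `⟨𝟙, Q⁻¹ 𝟙⟩ = k - ⟨𝟙, (Q - 1) 𝟙⟩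
+ …` turns the sum into the expectation of `exp (α² / n * ∑ i, S i)` over random signs, where
`S i = ∑_{s < t} σ s i * σ t i` are independent over the sites `i`. It is the `n`-th power of a
moment generating function with `𝔼 S = 0` and `𝔼 S² = k (k - 1) / 2`, hence equals
`exp (k (k - 1) α⁴ / (4 n) + O(α⁶ / n²))`. For the upper bound the quadratic form is estimated by
`Q⁻¹ ≥ 2 - Q`; for the lower bound the second-order term `‖Q - 1‖²` is controlled on average under
the weights `exp (α² / n * ∑ i, S i)` and pulled out of the exponential along a tangent line.

The other tuples are negligible because `exp (k α² / 2) = exp (o(n))`. If they are linearly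
independent, the integer matrix `n Q` has determinant at least one, so their density exceeds that of
an orthogonal tuple by a factor of at most `n ^ (k / 2) * exp (k α² / 2)`, while by Chernoff's bound
such tuples are exponentially rare. If they are dependent but no two are parallel, a basis of them
omits a sign pattern at every site, which again makes such tuples exponentially rare; and if two are
parallel, the joint window has probability zero.
-/

namespace NumberPartitioning

section GaussianDensity

open Matrix

variable {ι κ m : Type*} [Fintype m]

/-- The law of a family of independent standard normal variables. -/
noncomputable abbrev stdGaussianPi (m : Type*) [Fintype m] : Measure (m → ℝ) :=
  Measure.pi fun _ => gaussianReal 0 1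

lemma strongDual_pi_apply [DecidableEq m] (L : StrongDual ℝ (m → ℝ)) (v : m → ℝ) :
    L v = (fun s => L (Pi.single s 1)) ⬝ᵥ v := by
  conv_lhs => rw [pi_eq_sum_univ' v, map_sum]
  simp only [map_smul, smul_eq_mul, dotProduct, mul_comm]

lemma charFunDual_stdGaussianPi [DecidableEq m] (L : StrongDual ℝ (m → ℝ)) :
    charFunDual (stdGaussianPi m) L
      = Complex.exp (-((∑ i, L (Pi.single i 1) ^ 2 : ℝ) : ℂ) / 2) := by
  have hcoord (i : m) : charFunDual (gaussianReal 0 1) (L.comp (.single ℝ (fun _ => ℝ) i))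
      = Complex.exp (-((L (Pi.single i 1) ^ 2 : ℝ) : ℂ) / 2) := by
    have hL : ⇑(L.comp (.single ℝ (fun _ => ℝ) i)) = fun x => L (Pi.single i 1) * x := by
      ext x
      rw [mul_comm, ← smul_eq_mul x, ← map_smul, ← Pi.single_smul]
      simp
    rw [charFunDual_eq_charFun_map_one, hL, gaussianReal_map_const_mul, charFun_gaussianReal]
    congr 1
    simp
    ring
  rw [charFunDual_pi]
  simp_rw [hcoord, ← Complex.exp_sum, ← Finset.sum_div, Finset.sum_neg_distrib,
    Complex.ofReal_sum]

lemma charFunDual_map_mulVec_stdGaussianPi [Fintype ι] [DecidableEq ι] (A : Matrix ι m ℝ)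
    (L : StrongDual ℝ (ι → ℝ)) :
    charFunDual ((stdGaussianPi m).map (A *ᵥ ·)) L
      = Complex.exp (-(((fun s => L (Pi.single s 1)) ⬝ᵥ (A * Aᵀ) *ᵥ
          (fun s => L (Pi.single s 1)) : ℝ) : ℂ) / 2) := by
  classical
  change charFunDual ((stdGaussianPi m).map A.mulVecLin.toContinuousLinearMap) L = _
  rw [charFunDual_map, charFunDual_stdGaussianPi]
  congr 4
  rw [← mulVec_mulVec, dotProduct_mulVec, mulVec_transpose, dotProduct]
  refine Finset.sum_congr rfl fun i _ => ?_
  rw [ContinuousLinearMap.comp_apply, LinearMap.coe_toContinuousLinearMap', mulVecLin_apply,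
    strongDual_pi_apply L, dotProduct_mulVec, dotProduct_single, mul_one, sq]

lemma measurable_mulVec [Finite ι] (A : Matrix ι m ℝ) : Measurable (A *ᵥ · : (m → ℝ) → ι → ℝ) :=
  (continuous_const.matrix_mulVec continuous_id).measurable

lemma map_mulVec_stdGaussianPi_congr [Finite ι] [Fintype κ] {A : Matrix ι m ℝ} {B : Matrix ι κ ℝ}
    (h : A * Aᵀ = B * Bᵀ) :
    (stdGaussianPi m).map (A *ᵥ ·) = (stdGaussianPi κ).map (B *ᵥ ·) := by
  classical
  have := Fintype.ofFinite ι
  have := Measure.isProbabilityMeasure_map (μ := stdGaussianPi m) (measurable_mulVec A).aemeasurable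
  have := Measure.isProbabilityMeasure_map (μ := stdGaussianPi κ) (measurable_mulVec B).aemeasurable
  refine Measure.ext_of_charFunDual (funext fun L => ?_)
  rw [charFunDual_map_mulVec_stdGaussianPi, charFunDual_map_mulVec_stdGaussianPi, h]

variable [Fintype ι] [DecidableEq ι]

/-- The density of the centred normal law with covariance matrix `Q`. -/
noncomputable def gaussianDensity (Q : Matrix ι ι ℝ) (x : ι → ℝ) : ℝ :=
  (√(2 * Real.pi))⁻¹ ^ Fintype.card ι * (√Q.det)⁻¹ * Real.exp (-(x ⬝ᵥ Q⁻¹ *ᵥ x) / 2)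

lemma continuous_gaussianDensity (Q : Matrix ι ι ℝ) : Continuous (gaussianDensity Q) := by
  have : Continuous fun x : ι → ℝ => x ⬝ᵥ Q⁻¹ *ᵥ x :=
    continuous_id.dotProduct (continuous_const.matrix_mulVec continuous_id)
  unfold gaussianDensity
  fun_prop

lemma gaussianDensity_one (x : ι → ℝ) :
    gaussianDensity 1 x = ∏ i, gaussianPDFReal 0 1 (x i) := by
  simp only [gaussianDensity, gaussianPDFReal, Finset.prod_mul_distrib, Finset.prod_const,
    Finset.card_univ, ← Real.exp_sum, dotProduct, inv_one, one_mulVec, det_one, Real.sqrt_one,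
    NNReal.coe_one, mul_one, sub_zero, ← Finset.sum_div, Finset.sum_neg_distrib, sq]

lemma dotProduct_inv_mul_transpose_mulVec {B : Matrix ι ι ℝ} (hB : B.det ≠ 0) (x : ι → ℝ) :
    (B *ᵥ x) ⬝ᵥ (B * Bᵀ)⁻¹ *ᵥ (B *ᵥ x) = x ⬝ᵥ x := by
  have hBT : IsUnit Bᵀ.det := by rwa [det_transpose, isUnit_iff_ne_zero]
  rw [Matrix.mul_inv_rev, mulVec_mulVec, Matrix.mul_assoc, nonsing_inv_mul _ hB.isUnit,
    Matrix.mul_one, ← vecMul_transpose, ← dotProduct_mulVec, mulVec_mulVec,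
    mul_nonsing_inv _ hBT, one_mulVec]

lemma abs_det_mul_gaussianDensity_mulVec {B : Matrix ι ι ℝ} (hB : B.det ≠ 0) (x : ι → ℝ) :
    |B.det| * gaussianDensity (B * Bᵀ) (B *ᵥ x) = gaussianDensity 1 x := by
  have hB' : |B.det| ≠ 0 := abs_ne_zero.mpr hB
  simp only [gaussianDensity, dotProduct_inv_mul_transpose_mulVec hB, det_mul, det_transpose,
    Real.sqrt_mul_self_eq_abs, inv_one, det_one, one_mulVec, Real.sqrt_one]
  field_simp

lemma stdGaussianPi_eq_withDensity :
    stdGaussianPi ι = volume.withDensity fun x => ENNReal.ofReal (gaussianDensity 1 x) := by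
  refine Measure.pi_eq fun s hs => ?_
  have hint (i : ι) : Integrable (gaussianPDFReal 0 1) (volume.restrict (s i)) :=
    (integrable_gaussianPDFReal 0 1).restrict
  rw [withDensity_apply _ (MeasurableSet.univ_pi hs), volume_pi, Measure.restrict_pi_pi]
  simp_rw [gaussianDensity_one]
  rw [← ofReal_integral_eq_lintegral_ofReal (Integrable.fintype_prod hint)
    (Eventually.of_forall fun x => Finset.prod_nonneg fun i _ => gaussianPDFReal_nonneg _ _ _),
    integral_fintype_prod_eq_prod (fun _ => gaussianPDFReal 0 1), ENNReal.ofReal_prod_of_nonneg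
    fun i _ => integral_nonneg fun x => gaussianPDFReal_nonneg _ _ _]
  refine Finset.prod_congr rfl fun i _ => ?_
  rw [gaussianReal_apply_eq_integral _ one_ne_zero]

lemma map_mulVec_withDensity_abs_det_mul {B : Matrix ι ι ℝ} (hB : B.det ≠ 0)
    {f : (ι → ℝ) → ℝ≥0∞} (hf : Measurable f) :
    (volume.withDensity fun x => ENNReal.ofReal |B.det| * f (B *ᵥ x)).map (B *ᵥ ·)
      = volume.withDensity f := by
  have hvol : (volume : Measure (ι → ℝ))
      = ENNReal.ofReal |B.det| • volume.map (B *ᵥ ·) := by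
    change _ = _ • volume.map (toLin' B)
    rw [Real.map_matrix_volume_pi_eq_smul_volume_pi hB, smul_smul,
      ← ENNReal.ofReal_mul (abs_nonneg _), ← abs_mul, mul_inv_cancel₀ hB]
    simp
  ext S hS
  conv_rhs => rw [hvol]
  rw [Measure.map_apply (measurable_mulVec B) hS, withDensity_apply _ (measurable_mulVec B hS),
    withDensity_apply _ hS, Measure.restrict_smul, lintegral_smul_measure,
    setLIntegral_map hS hf (measurable_mulVec B), lintegral_const_mul' _ _ ENNReal.ofReal_ne_top,
    smul_eq_mul]

lemma map_mulVec_stdGaussianPi_eq_withDensity {A : Matrix ι m ℝ} (hA : (A * Aᵀ).PosDef) :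
    (stdGaussianPi m).map (A *ᵥ ·)
      = volume.withDensity fun x => ENNReal.ofReal (gaussianDensity (A * Aᵀ) x) := by
  obtain ⟨B, hB⟩ : ∃ B : Matrix ι ι ℝ, A * Aᵀ = B * Bᵀ := by
    open scoped MatrixOrder in
    obtain ⟨B, hB⟩ := CStarAlgebra.nonneg_iff_eq_star_mul_self.mp hA.posSemidef.nonneg
    exact ⟨Bᵀ, by rw [hB, star_eq_conjTranspose, conjTranspose_eq_transpose_of_trivial,
      transpose_transpose]⟩
  have hdet : B.det ≠ 0 := fun h => hA.det_pos.ne' (by rw [hB, det_mul, h, zero_mul])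
  rw [map_mulVec_stdGaussianPi_congr hB, hB, stdGaussianPi_eq_withDensity,
    ← map_mulVec_withDensity_abs_det_mul hdet
      (continuous_gaussianDensity (B * Bᵀ)).measurable.ennreal_ofReal]
  simp_rw [← ENNReal.ofReal_mul (abs_nonneg B.det), abs_det_mul_gaussianDensity_mulVec hdet]

end GaussianDensity

section QuadraticForm

open Matrix

variable {ι : Type*} [Fintype ι]

lemma dotProduct_mulVec_eq_sum (Q : Matrix ι ι ℝ) (x : ι → ℝ) :
    x ⬝ᵥ Q *ᵥ x = ∑ s, ∑ t, Q s t * (x s * x t) := by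
  simp only [dotProduct, mulVec, Finset.mul_sum, mul_left_comm (x _)]

lemma abs_dotProduct_mulVec_le {M : Matrix ι ι ℝ} {ε : ℝ} (hM : ∀ s t, |M s t| ≤ ε) (x : ι → ℝ) :
    |x ⬝ᵥ M *ᵥ x| ≤ Fintype.card ι * ε * (x ⬝ᵥ x) := by
  have hterm (s t : ι) : |M s t * (x s * x t)| ≤ ε * ((x s * x s + x t * x t) / 2) := by
    rw [abs_mul]
    refine mul_le_mul (hM s t) (abs_le.mpr ⟨?_, ?_⟩) (abs_nonneg _)
      ((abs_nonneg _).trans (hM s t))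
    · nlinarith [sq_nonneg (x s + x t)]
    · nlinarith [sq_nonneg (x s - x t)]
  rw [dotProduct_mulVec_eq_sum]
  calc |∑ s, ∑ t, M s t * (x s * x t)|
      ≤ ∑ s, ∑ t, ε * ((x s * x s + x t * x t) / 2) :=
        (Finset.abs_sum_le_sum_abs _ _).trans <| Finset.sum_le_sum fun s _ =>
          (Finset.abs_sum_le_sum_abs _ _).trans <| Finset.sum_le_sum fun t _ => hterm s t
    _ = Fintype.card ι * ε * (x ⬝ᵥ x) := by
        simp only [← Finset.mul_sum, ← Finset.sum_div, Finset.sum_add_distrib, Finset.sum_const,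
          Finset.card_univ, nsmul_eq_mul, dotProduct, mul_left_comm (x _)]
        ring

lemma abs_dotProduct_mulVec_sub_le {M : Matrix ι ι ℝ} (hM : ∀ s t, |M s t| ≤ 1) {a b : ℝ}
    (ha : 0 ≤ a) {x : ι → ℝ} (hx : ∀ s, x s ∈ Set.Icc a b) :
    |x ⬝ᵥ M *ᵥ x - a ^ 2 * ∑ s, ∑ t, M s t| ≤ Fintype.card ι ^ 2 * (b ^ 2 - a ^ 2) := by
  have hterm (s t : ι) : |M s t * (x s * x t - a ^ 2)| ≤ b ^ 2 - a ^ 2 := by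
    have hlow : a ^ 2 ≤ x s * x t := by
      simpa only [sq] using mul_le_mul (hx s).1 (hx t).1 ha (ha.trans (hx s).1)
    have hupp : x s * x t ≤ b ^ 2 := by
      simpa only [sq] using
        mul_le_mul (hx s).2 (hx t).2 (ha.trans (hx t).1) (ha.trans ((hx s).1.trans (hx s).2))
    rw [abs_mul, abs_of_nonneg (sub_nonneg.mpr hlow)]
    exact (mul_le_of_le_one_left (sub_nonneg.mpr hlow) (hM s t)).trans (sub_le_sub_right hupp _)
  calc |x ⬝ᵥ M *ᵥ x - a ^ 2 * ∑ s, ∑ t, M s t|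
      = |∑ s, ∑ t, M s t * (x s * x t - a ^ 2)| := by
        simp only [dotProduct_mulVec_eq_sum, mul_sub, Finset.sum_sub_distrib, ← Finset.sum_mul,
          mul_comm (a ^ 2)]
    _ ≤ ∑ _ : ι, ∑ _ : ι, (b ^ 2 - a ^ 2) :=
        (Finset.abs_sum_le_sum_abs _ _).trans <| Finset.sum_le_sum fun s _ =>
          (Finset.abs_sum_le_sum_abs _ _).trans <| Finset.sum_le_sum fun t _ => hterm s t
    _ = Fintype.card ι ^ 2 * (b ^ 2 - a ^ 2) := by
        simp only [Finset.sum_const, Finset.card_univ, nsmul_eq_mul]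
        ring

lemma mulVec_dotProduct_mulVec_le (M : Matrix ι ι ℝ) (x : ι → ℝ) :
    (M *ᵥ x) ⬝ᵥ (M *ᵥ x) ≤ (∑ s, ∑ t, M s t ^ 2) * (x ⬝ᵥ x) := by
  rw [dotProduct, Finset.sum_mul]
  refine Finset.sum_le_sum fun s _ => ?_
  simpa only [mulVec, dotProduct, ← sq] using Finset.sum_mul_sq_le_sq_mul_sq Finset.univ (M s) x

variable [DecidableEq ι]

lemma dotProduct_inv_mulVec_eq {Q : Matrix ι ι ℝ} (hQ : Q.PosDef) (x : ι → ℝ) :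
    x ⬝ᵥ Q⁻¹ *ᵥ x
      = 2 * (x ⬝ᵥ x) - x ⬝ᵥ Q *ᵥ x + (x - Q⁻¹ *ᵥ x) ⬝ᵥ Q *ᵥ (x - Q⁻¹ *ᵥ x) := by
  have hinv : Q *ᵥ (Q⁻¹ *ᵥ x) = x := by
    rw [mulVec_mulVec, mul_nonsing_inv _ hQ.det_pos.ne'.isUnit, one_mulVec]
  have hsymm : (Q⁻¹ *ᵥ x) ⬝ᵥ Q *ᵥ x = x ⬝ᵥ x := by
    rw [dotProduct_mulVec, ← mulVec_transpose, ← conjTranspose_eq_transpose_of_trivial,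
      hQ.isHermitian.eq, hinv]
  rw [mulVec_sub, hinv, dotProduct_sub, sub_dotProduct, sub_dotProduct, hsymm,
    dotProduct_comm (Q⁻¹ *ᵥ x) x]
  ring

lemma le_dotProduct_inv_mulVec {Q : Matrix ι ι ℝ} (hQ : Q.PosDef) (x : ι → ℝ) :
    2 * (x ⬝ᵥ x) - x ⬝ᵥ Q *ᵥ x ≤ x ⬝ᵥ Q⁻¹ *ᵥ x := by
  rw [dotProduct_inv_mulVec_eq hQ x]
  exact le_add_of_nonneg_right (hQ.posSemidef.dotProduct_mulVec_nonneg (x - Q⁻¹ *ᵥ x))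

lemma dotProduct_inv_mulVec_le {Q : Matrix ι ι ℝ} (hQ : Q.PosDef)
    (hhalf : ∀ z, (z ⬝ᵥ z) / 2 ≤ z ⬝ᵥ Q *ᵥ z) (x : ι → ℝ) :
    x ⬝ᵥ Q⁻¹ *ᵥ x
      ≤ 2 * (x ⬝ᵥ x) - x ⬝ᵥ Q *ᵥ x + 2 * (((Q - 1) *ᵥ x) ⬝ᵥ ((Q - 1) *ᵥ x)) := by
  rw [dotProduct_inv_mulVec_eq hQ x]
  have hQz : Q *ᵥ (x - Q⁻¹ *ᵥ x) = (Q - 1) *ᵥ x := by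
    rw [mulVec_sub, mulVec_mulVec, mul_nonsing_inv _ hQ.det_pos.ne'.isUnit, one_mulVec,
      sub_mulVec, one_mulVec]
  have hz := hhalf (x - Q⁻¹ *ᵥ x)
  rw [hQz] at hz ⊢
  set z := x - Q⁻¹ *ᵥ x
  set u := (Q - 1) *ᵥ x
  have hyoung : z ⬝ᵥ u ≤ (z ⬝ᵥ z) / 4 + u ⬝ᵥ u := by
    have := dotProduct_star_self_nonneg ((1 / 2 : ℝ) • z - u)
    simp only [star_trivial, sub_dotProduct, dotProduct_sub, smul_dotProduct, dotProduct_smul,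
      smul_eq_mul,
      dotProduct_comm u z] at this
    linarith
  linarith

lemma half_dotProduct_le_of_abs_sub_one_le {Q : Matrix ι ι ℝ} {ε : ℝ}
    (hQ : ∀ s t, |(Q - 1) s t| ≤ ε) (hε : Fintype.card ι * ε ≤ 1 / 2) (z : ι → ℝ) :
    (z ⬝ᵥ z) / 2 ≤ z ⬝ᵥ Q *ᵥ z := by
  have hsplit : z ⬝ᵥ Q *ᵥ z = z ⬝ᵥ z + z ⬝ᵥ (Q - 1) *ᵥ z := by
    rw [sub_mulVec, dotProduct_sub, one_mulVec]
    ring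
  have hdiff := (abs_le.mp (abs_dotProduct_mulVec_le hQ z)).1
  have hz : Fintype.card ι * ε * (z ⬝ᵥ z) ≤ 1 / 2 * (z ⬝ᵥ z) :=
    mul_le_mul_of_nonneg_right hε (dotProduct_star_self_nonneg z)
  linarith

lemma posDef_of_abs_sub_one_le {Q : Matrix ι ι ℝ} (hQ : Q.IsHermitian) {ε : ℝ}
    (hQε : ∀ s t, |(Q - 1) s t| ≤ ε) (hε : Fintype.card ι * ε ≤ 1 / 2) : Q.PosDef := by
  refine .of_dotProduct_mulVec_pos hQ fun z hz => ?_
  exact (half_pos (dotProduct_star_self_pos_iff.mpr hz)).trans_le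
    (half_dotProduct_le_of_abs_sub_one_le hQε hε z)

lemma exists_abs_inv_sqrt_det_sub_one_le (ι : Type*) [Fintype ι] [DecidableEq ι] {δ : ℝ}
    (hδ : 0 < δ) :
    ∃ ε > 0, ∀ Q : Matrix ι ι ℝ, (∀ s t, |(Q - 1) s t| ≤ ε) → |(√Q.det)⁻¹ - 1| ≤ δ := by
  have hcont : ContinuousAt (fun Q : ι → ι → ℝ => (√(of Q).det)⁻¹) (1 : Matrix ι ι ℝ) := by
    refine (Real.continuous_sqrt.comp (Continuous.matrix_det continuous_id)).continuousAt.inv₀ ?_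
    change √(1 : Matrix ι ι ℝ).det ≠ 0
    simp
  obtain ⟨ε, hε, h⟩ := Metric.continuousAt_iff.mp hcont δ hδ
  refine ⟨ε / 2, half_pos hε, fun Q hQ => ?_⟩
  have hdist : @dist (ι → ι → ℝ) _ Q (1 : Matrix ι ι ℝ) ≤ ε / 2 :=
    (dist_pi_le_iff (half_pos hε).le).mpr fun s =>
      (dist_pi_le_iff (half_pos hε).le).mpr fun t => hQ s t
  have hdet : |(√Q.det)⁻¹ - (√(1 : Matrix ι ι ℝ).det)⁻¹| < δ :=
    h (hdist.trans_lt (half_lt_self hε))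
  rw [det_one, Real.sqrt_one, inv_one] at hdet
  exact hdet.le

end QuadraticForm

section Overlap

open Matrix

variable {ι : Type*} {n : ℕ}

/-- The real `±1` matrix whose rows are the given configurations. -/
def signMatrix (σ : ι → Spin n) : Matrix ι (Fin n) ℝ :=
  of fun s i => ((σ s i : ℤ) : ℝ)

/-- The overlap matrix `n⁻¹ ∑ᵢ σₛ(i) σₜ(i)` of a tuple of configurations: the covariance matrix of
the signed energies `n^{-1/2} ∑ᵢ σₛ(i) xᵢ` under standard normal weights. -/
noncomputable def overlap (σ : ι → Spin n) : Matrix ι ι ℝ :=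
  (n : ℝ)⁻¹ • (signMatrix σ * (signMatrix σ)ᵀ)

lemma overlap_apply (σ : ι → Spin n) (s t : ι) :
    overlap σ s t = (∑ i, ((σ s i : ℤ) : ℝ) * ((σ t i : ℤ) : ℝ)) / n := by
  simp [overlap, signMatrix, Matrix.mul_apply, div_eq_inv_mul]

lemma coe_units_mul_self (u : ℤˣ) : ((u : ℤ) : ℝ) * ((u : ℤ) : ℝ) = 1 := by
  rcases Int.units_eq_one_or u with rfl | rfl <;> simp

lemma abs_coe_units (u : ℤˣ) : |((u : ℤ) : ℝ)| = 1 := by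
  rcases Int.units_eq_one_or u with rfl | rfl <;> simp

lemma overlap_self (hn : 0 < n) (σ : ι → Spin n) (s : ι) : overlap σ s s = 1 := by
  simp [overlap_apply, coe_units_mul_self, hn.ne']

lemma abs_overlap_le_one (σ : ι → Spin n) (s t : ι) : |overlap σ s t| ≤ 1 := by
  rw [overlap_apply, abs_div, Nat.abs_cast]
  refine div_le_one_of_le₀ ((Finset.abs_sum_le_sum_abs _ _).trans ?_) n.cast_nonneg
  simp [abs_mul, abs_coe_units]

lemma sq_overlap_sub_one_le_one [DecidableEq ι] (hn : 0 < n) (σ : ι → Spin n) (s t : ι) :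
    (overlap σ - 1) s t ^ 2 ≤ 1 := by
  rw [sq_le_one_iff_abs_le_one, Matrix.sub_apply]
  rcases eq_or_ne s t with rfl | hst
  · simp [overlap_self hn]
  · simpa [one_apply_ne hst] using abs_overlap_le_one σ s t

lemma isHermitian_overlap (σ : ι → Spin n) : (overlap σ).IsHermitian := by
  ext s t
  simp [overlap_apply, mul_comm]

/-- A tuple of configurations is `ε`-orthogonal if its overlap matrix is entrywise within `ε` of
the identity matrix. -/
def IsNearOrthogonal [DecidableEq ι] (ε : ℝ) (σ : ι → Spin n) : Prop :=
  ∀ s t, |(overlap σ - 1) s t| ≤ ε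

lemma injective_of_isNearOrthogonal [DecidableEq ι] (hn : 0 < n) {σ : ι → Spin n} {ε : ℝ}
    (hε : ε < 1) (hσ : IsNearOrthogonal ε σ) : Function.Injective σ := by
  intro s t hst
  by_contra hne
  have hrow : overlap σ s t = overlap σ s s := by simp only [overlap_apply, hst]
  have h := hσ s t
  rw [Matrix.sub_apply, Matrix.one_apply_ne hne, sub_zero, hrow, overlap_self hn, abs_one] at h
  exact hε.not_ge h

lemma posDef_signMatrix_mul_transpose [Finite ι] {σ : ι → Spin n}
    (hσ : LinearIndependent ℝ (signMatrix σ).row) :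
    (signMatrix σ * (signMatrix σ)ᵀ).PosDef := by
  rw [← conjTranspose_eq_transpose_of_trivial]
  have _ := Fintype.ofFinite ι
  exact .mul_conjTranspose_self _ (vecMul_injective_iff.mpr hσ)

lemma posDef_overlap_of_linearIndependent [Finite ι] (hn : 0 < n) {σ : ι → Spin n}
    (hσ : LinearIndependent ℝ (signMatrix σ).row) : (overlap σ).PosDef :=
  (posDef_signMatrix_mul_transpose hσ).smul (by positivity)

variable [Fintype ι]

/-- The sum `∑_{s<t} yₛ yₜ` over the pairs of entries of a sign pattern, written without an order
on the index type as `((∑ₛ yₛ)² - k) / 2`. -/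
noncomputable def pairSum (y : ι → ℤˣ) : ℝ :=
  ((∑ s, ((y s : ℤ) : ℝ)) ^ 2 - Fintype.card ι) / 2

lemma abs_pairSum_le (y : ι → ℤˣ) : |pairSum y| ≤ (Fintype.card ι : ℝ) ^ 2 := by
  have habs : |∑ s, ((y s : ℤ) : ℝ)| ≤ Fintype.card ι :=
    (Finset.abs_sum_le_sum_abs _ _).trans (by simp [abs_coe_units])
  have hsq : (∑ s, ((y s : ℤ) : ℝ)) ^ 2 ≤ (Fintype.card ι : ℝ) ^ 2 :=
    sq_le_sq' (abs_le.mp habs).1 (abs_le.mp habs).2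
  have hcard : (Fintype.card ι : ℝ) ≤ (Fintype.card ι : ℝ) ^ 2 := by
    exact_mod_cast Nat.le_self_pow two_ne_zero _
  rw [pairSum, abs_le]
  constructor <;> linarith [sq_nonneg (∑ s, ((y s : ℤ) : ℝ)), sq_nonneg (Fintype.card ι : ℝ)]

lemma sum_overlap (hn : 0 < n) (σ : ι → Spin n) :
    ∑ s, ∑ t, overlap σ s t
      = Fintype.card ι + 2 / n * ∑ i, pairSum fun s => σ s i := by
  have hsq : ∑ s, ∑ t, overlap σ s t = (∑ i, (∑ s, ((σ s i : ℤ) : ℝ)) ^ 2) / n := by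
    simp only [overlap_apply, ← Finset.sum_div, sq, Finset.sum_mul_sum]
    rw [Finset.sum_congr rfl fun s _ => Finset.sum_comm, Finset.sum_comm]
  rw [hsq]
  simp only [pairSum, ← Finset.sum_div, Finset.sum_sub_distrib, Finset.sum_const, Finset.card_univ,
    Fintype.card_fin, nsmul_eq_mul]
  field

variable [DecidableEq ι]

/-- The squared Frobenius distance of the overlap matrix from the identity matrix. -/
noncomputable def overlapDefect (σ : ι → Spin n) : ℝ :=
  ∑ s, ∑ t, (overlap σ - 1) s t ^ 2

lemma overlapDefect_nonneg (σ : ι → Spin n) : 0 ≤ overlapDefect σ :=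
  Finset.sum_nonneg fun _ _ => Finset.sum_nonneg fun _ _ => sq_nonneg _

lemma overlapDefect_le_card_sq (hn : 0 < n) (σ : ι → Spin n) :
    overlapDefect σ ≤ Fintype.card ι ^ 2 := by
  calc overlapDefect σ ≤ ∑ _ : ι, ∑ _ : ι, (1 : ℝ) :=
        Finset.sum_le_sum fun s _ => Finset.sum_le_sum fun t _ => sq_overlap_sub_one_le_one hn σ s t
    _ = Fintype.card ι ^ 2 := by simp [sq]

lemma isNearOrthogonal_of_overlapDefect_le {σ : ι → Spin n} {ε : ℝ} (hε : 0 ≤ ε)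
    (hσ : overlapDefect σ ≤ ε ^ 2) : IsNearOrthogonal ε σ := by
  refine fun s t => abs_le_of_sq_le_sq (le_trans ?_ hσ) hε
  calc (overlap σ - 1) s t ^ 2 ≤ ∑ t, (overlap σ - 1) s t ^ 2 :=
        Finset.single_le_sum (fun _ _ => sq_nonneg _) (Finset.mem_univ t)
    _ ≤ overlapDefect σ :=
        Finset.single_le_sum (f := fun s => ∑ t, (overlap σ - 1) s t ^ 2)
          (fun _ _ => Finset.sum_nonneg fun _ _ => sq_nonneg _) (Finset.mem_univ s)

lemma one_le_det_signMatrix_mul_transpose {σ : ι → Spin n}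
    (hσ : LinearIndependent ℝ (signMatrix σ).row) :
    1 ≤ (signMatrix σ * (signMatrix σ)ᵀ).det := by
  have hpos := (posDef_signMatrix_mul_transpose hσ).det_pos
  set S : Matrix ι (Fin n) ℤ := of fun s i => (σ s i : ℤ)
  have hdet : (signMatrix σ * (signMatrix σ)ᵀ).det = ((S * Sᵀ).det : ℤ) := by
    rw [Int.cast_det]
    congr 1
    ext s t
    simp [S, signMatrix, Matrix.mul_apply]
  rw [hdet] at hpos ⊢
  exact_mod_cast Int.add_one_le_of_lt (Int.cast_pos.mp hpos)

lemma inv_sqrt_det_overlap_le (hn : 0 < n) {σ : ι → Spin n}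
    (hσ : LinearIndependent ℝ (signMatrix σ).row) :
    (√(overlap σ).det)⁻¹ ≤ √n ^ Fintype.card ι := by
  have hpow : √n ^ Fintype.card ι = √((n : ℝ) ^ Fintype.card ι) := by
    rw [eq_comm, Real.sqrt_eq_iff_mul_self_eq (by positivity) (by positivity), ← mul_pow,
      Real.mul_self_sqrt n.cast_nonneg]
  rw [hpow, ← Real.sqrt_inv]
  refine Real.sqrt_le_sqrt (inv_le_of_inv_le₀ (by positivity) ?_)
  rw [overlap, det_smul, inv_pow]
  exact le_mul_of_one_le_right (by positivity) (one_le_det_signMatrix_mul_transpose hσ)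

end Overlap

section Scaling

variable {n : ℕ}

lemma scaling_pos (n : ℕ) (α : ℝ) : 0 < scaling n α := by
  unfold scaling energyDensity
  positivity

lemma scaling_eq (hn : 0 < n) (α : ℝ) :
    scaling n α = √(2 * Real.pi) * Real.exp (α ^ 2 / 2) / 2 ^ n := by
  have hsqrt : √(2 / Real.pi) = 2 / √(2 * Real.pi) := by
    rw [eq_div_iff (by positivity), ← Real.sqrt_mul (by positivity),
      show 2 / Real.pi * (2 * Real.pi) = 2 ^ 2 by field, Real.sqrt_sq zero_le_two]
  rw [scaling, energyDensity, hsqrt, neg_div, Real.exp_neg, ← pow_sub_one_mul hn.ne' (2 : ℝ)]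
  field

lemma gaussianNorm_mul_prod_scaling {ι : Type*} [Fintype ι] (hn : 0 < n) (α : ℝ) (γ : ι → ℝ) :
    (√(2 * Real.pi))⁻¹ ^ Fintype.card ι * ∏ s, (γ s * scaling n α)
      = (∏ s, γ s) / 2 ^ (n * Fintype.card ι) * Real.exp (Fintype.card ι * α ^ 2 / 2) := by
  rw [Finset.prod_mul_distrib, Finset.prod_const, Finset.card_univ, scaling_eq hn, div_pow,
    mul_pow, ← Real.exp_nat_mul, ← pow_mul, inv_pow, mul_div_assoc (Fintype.card ι : ℝ)]
  field

/-- The excess `(α + K ξ)² - α²`, which bounds `x y - α²` for `x`, `y` in the window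
`[α, α + K ξ]`. -/
noncomputable def windowError (n : ℕ) (α K : ℝ) : ℝ :=
  (α + K * scaling n α) ^ 2 - α ^ 2

lemma windowError_nonneg {α K : ℝ} (hα : 0 ≤ α) (hK : 0 ≤ K) (n : ℕ) : 0 ≤ windowError n α K :=
  sub_nonneg.mpr <| pow_le_pow_left₀ hα
    (le_add_of_nonneg_right (mul_nonneg hK (scaling_pos n α).le)) 2

end Scaling

section WindowProb

open Matrix

variable {ι : Type*} {n : ℕ}

/-- The signed energy `n^{-1/2} ∑ᵢ σᵢ xᵢ`, whose absolute value is the energy. -/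
noncomputable def signedEnergy (x : Fin n → ℝ) (σ : Spin n) : ℝ :=
  (∑ i, ((σ i : ℤ) : ℝ) * x i) / √(n : ℝ)

/-- The set of weights for which the signed energies of the tuple `σ` lie in the windows
`[α + cₛ ξ, α + dₛ ξ]`. -/
def energyWindow (σ : ι → Spin n) (α : ℝ) (c d : ι → ℝ) : Set (Fin n → ℝ) :=
  {x | ∀ s, signedEnergy x (σ s) ∈ Set.Icc (α + c s * scaling n α) (α + d s * scaling n α)}

/-- The probability of `energyWindow σ α c d` for standard normal weights. -/
noncomputable def windowProb (σ : ι → Spin n) (α : ℝ) (c d : ι → ℝ) : ℝ :=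
  (stdGaussianPi (Fin n)).real (energyWindow σ α c d)

lemma windowProb_nonneg (σ : ι → Spin n) (α : ℝ) (c d : ι → ℝ) : 0 ≤ windowProb σ α c d :=
  measureReal_nonneg

lemma windowProb_le_comp_val (σ : ι → Spin n) (α : ℝ) (c d : ι → ℝ) (J : Finset ι) :
    windowProb σ α c d
      ≤ windowProb (fun j : J => σ j) α (fun j => c j) (fun j => d j) :=
  measureReal_mono fun _ hx j => hx j

lemma mem_Icc_of_mem_window {α K : ℝ} {c d x : ι → ℝ} (hc : ∀ s, 0 ≤ c s) (hK : ∀ s, d s ≤ K)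
    (hx : x ∈ Set.Icc (fun s => α + c s * scaling n α) (fun s => α + d s * scaling n α)) (s : ι) :
    x s ∈ Set.Icc α (α + K * scaling n α) :=
  ⟨(le_add_of_nonneg_right (mul_nonneg (hc s) (scaling_pos n α).le)).trans (hx.1 s),
    (hx.2 s).trans <|
      add_le_add_right (mul_le_mul_of_nonneg_right (hK s) (scaling_pos n α).le) α⟩

variable [Fintype ι]

lemma setIntegral_mul_const_window (hn : 0 < n) (α : ℝ) {c d : ι → ℝ} (hcd : ∀ s, c s ≤ d s)
    (D : ℝ) :
    (√(2 * Real.pi))⁻¹ ^ Fintype.card ι * Real.exp (-(Fintype.card ι * α ^ 2 / 2))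
      * ∫ _ in Set.Icc (fun s => α + c s * scaling n α) (fun s => α + d s * scaling n α), D
      = (∏ s, (d s - c s)) / 2 ^ (n * Fintype.card ι) * D := by
  have hle : (fun s => α + c s * scaling n α) ≤ fun s => α + d s * scaling n α := fun s =>
    add_le_add_right (mul_le_mul_of_nonneg_right (hcd s) (scaling_pos n α).le) α
  have hnorm := gaussianNorm_mul_prod_scaling hn α fun s => d s - c s
  rw [setIntegral_const, Measure.real, Real.volume_Icc_pi_toReal hle, smul_eq_mul]
  simp only [add_sub_add_left_eq_sub, ← sub_mul]
  calc _ = ((√(2 * Real.pi))⁻¹ ^ Fintype.card ι * ∏ s, ((d s - c s) * scaling n α))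
        * Real.exp (-(Fintype.card ι * α ^ 2 / 2)) * D := by ring
    _ = _ := by
        rw [hnorm, mul_assoc (_ / _), ← Real.exp_add, add_neg_cancel, Real.exp_zero, mul_one]

variable [DecidableEq ι]

omit [DecidableEq ι] in
lemma abs_two_mul_dotProduct_sub_le (hn : 0 < n) (σ : ι → Spin n) {α B : ℝ} (hα : 0 ≤ α)
    {x : ι → ℝ} (hx : ∀ s, x s ∈ Set.Icc α B) :
    |2 * (x ⬝ᵥ x) - x ⬝ᵥ overlap σ *ᵥ x
        - (Fintype.card ι * α ^ 2 - 2 * (α ^ 2 / n * ∑ i, pairSum fun s => σ s i))|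
      ≤ 3 * Fintype.card ι ^ 2 * (B ^ 2 - α ^ 2) := by
  classical
  have hone : |x ⬝ᵥ x - α ^ 2 * Fintype.card ι| ≤ Fintype.card ι ^ 2 * (B ^ 2 - α ^ 2) := by
    simpa [one_apply] using abs_dotProduct_mulVec_sub_le (M := (1 : Matrix ι ι ℝ))
      (fun s t => by rw [one_apply]; split_ifs <;> simp) hα hx
  have hoverlap := abs_dotProduct_mulVec_sub_le (abs_overlap_le_one σ) hα hx
  have hsum : α ^ 2 * (Fintype.card ι + 2 / n * ∑ i, pairSum fun s => σ s i)
      = Fintype.card ι * α ^ 2 + 2 * (α ^ 2 / n * ∑ i, pairSum fun s => σ s i) := by ring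
  rw [sum_overlap hn, hsum] at hoverlap
  rw [abs_le] at hone hoverlap ⊢
  constructor <;> linarith [hone.1, hone.2, hoverlap.1, hoverlap.2]

lemma windowProb_eq_integral {σ : ι → Spin n} (hσ : (overlap σ).PosDef) (α : ℝ) (c d : ι → ℝ) :
    windowProb σ α c d
      = ∫ x in Set.Icc (fun s => α + c s * scaling n α) (fun s => α + d s * scaling n α),
          gaussianDensity (overlap σ) x := by
  set A := (√(n : ℝ))⁻¹ • signMatrix σ
  have hA : A * Aᵀ = overlap σ := by
    rw [transpose_smul, Matrix.smul_mul, Matrix.mul_smul, smul_smul, overlap, ← mul_inv,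
      Real.mul_self_sqrt n.cast_nonneg]
  have henergy (x : Fin n → ℝ) (s : ι) : signedEnergy x (σ s) = (A *ᵥ x) s := by
    simp [A, signedEnergy, signMatrix, mulVec, dotProduct, div_eq_inv_mul, Finset.mul_sum,
      mul_assoc]
  rw [integral_eq_lintegral_of_nonneg_ae
      (ae_of_all _ fun x => by unfold gaussianDensity; positivity)
      (continuous_gaussianDensity _).aestronglyMeasurable,
    ← withDensity_apply _ measurableSet_Icc, ← hA,
    ← map_mulVec_stdGaussianPi_eq_withDensity (hA ▸ hσ),
    Measure.map_apply (measurable_mulVec A) measurableSet_Icc, windowProb, energyWindow,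
    Measure.real]
  congr 2
  ext x
  simp only [Set.mem_ofPred_eq, Set.mem_preimage, Set.mem_Icc, Pi.le_def, ← forall_and, henergy]

/-- The factor by which the density of the signed energies of a tuple with overlap matrix `Q`
exceeds the density `(2π)^{-k/2} exp(-k α² / 2)` of `k` independent ones at `(α, …, α)`. -/
noncomputable def densityRatio (Q : Matrix ι ι ℝ) (α : ℝ) (x : ι → ℝ) : ℝ :=
  (√Q.det)⁻¹ * Real.exp ((Fintype.card ι * α ^ 2 - x ⬝ᵥ Q⁻¹ *ᵥ x) / 2)

lemma gaussianDensity_eq_mul_densityRatio (Q : Matrix ι ι ℝ) (α : ℝ) (x : ι → ℝ) :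
    gaussianDensity Q x = (√(2 * Real.pi))⁻¹ ^ Fintype.card ι
      * Real.exp (-(Fintype.card ι * α ^ 2 / 2)) * densityRatio Q α x := by
  rw [gaussianDensity, densityRatio, mul_mul_mul_comm, ← Real.exp_add]
  ring_nf

lemma continuous_densityRatio (Q : Matrix ι ι ℝ) (α : ℝ) : Continuous (densityRatio Q α) := by
  have : Continuous fun x : ι → ℝ => x ⬝ᵥ Q⁻¹ *ᵥ x :=
    continuous_id.dotProduct (continuous_const.matrix_mulVec continuous_id)
  unfold densityRatio
  fun_prop

lemma windowProb_le_of_densityRatio_le (hn : 0 < n) {σ : ι → Spin n} (hσ : (overlap σ).PosDef)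
    {α : ℝ} {c d : ι → ℝ} (hcd : ∀ s, c s ≤ d s) {D : ℝ}
    (hD : ∀ x ∈ Set.Icc (fun s => α + c s * scaling n α) (fun s => α + d s * scaling n α),
      densityRatio (overlap σ) α x ≤ D) :
    windowProb σ α c d ≤ (∏ s, (d s - c s)) / 2 ^ (n * Fintype.card ι) * D := by
  rw [windowProb_eq_integral hσ, ← setIntegral_mul_const_window hn α hcd]
  simp only [gaussianDensity_eq_mul_densityRatio _ α, integral_const_mul]
  exact mul_le_mul_of_nonneg_left (setIntegral_mono_on
    (continuous_densityRatio _ α).continuousOn.integrableOn_Icc continuousOn_const.integrableOn_Icc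
    measurableSet_Icc hD) (by positivity)

lemma le_windowProb_of_le_densityRatio (hn : 0 < n) {σ : ι → Spin n} (hσ : (overlap σ).PosDef)
    {α : ℝ} {c d : ι → ℝ} (hcd : ∀ s, c s ≤ d s) {D : ℝ}
    (hD : ∀ x ∈ Set.Icc (fun s => α + c s * scaling n α) (fun s => α + d s * scaling n α),
      D ≤ densityRatio (overlap σ) α x) :
    (∏ s, (d s - c s)) / 2 ^ (n * Fintype.card ι) * D ≤ windowProb σ α c d := by
  rw [windowProb_eq_integral hσ, ← setIntegral_mul_const_window hn α hcd]
  simp only [gaussianDensity_eq_mul_densityRatio _ α, integral_const_mul]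
  exact mul_le_mul_of_nonneg_left (setIntegral_mono_on continuousOn_const.integrableOn_Icc
    (continuous_densityRatio _ α).continuousOn.integrableOn_Icc measurableSet_Icc hD)
    (by positivity)

omit [DecidableEq ι] in
lemma windowProb_le_of_linearIndependent (hn : 0 < n) {σ : ι → Spin n}
    (hσ : LinearIndependent ℝ (signMatrix σ).row) {α : ℝ} {c d : ι → ℝ} (hcd : ∀ s, c s ≤ d s) :
    windowProb σ α c d ≤ (∏ s, (d s - c s)) / 2 ^ (n * Fintype.card ι)
      * (√n ^ Fintype.card ι * Real.exp (Fintype.card ι * α ^ 2 / 2)) := by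
  classical
  have hQ := posDef_overlap_of_linearIndependent hn hσ
  refine windowProb_le_of_densityRatio_le hn hQ hcd fun x _ => ?_
  have hnonneg : 0 ≤ x ⬝ᵥ (overlap σ)⁻¹ *ᵥ x := hQ.inv.posSemidef.dotProduct_mulVec_nonneg x
  refine mul_le_mul (inv_sqrt_det_overlap_le hn hσ) (Real.exp_le_exp.mpr ?_) (by positivity)
    (by positivity)
  linarith

lemma windowProb_le_exp_pairSum (hn : 0 < n) {σ : ι → Spin n} (hσ : (overlap σ).PosDef) {α K : ℝ}
    (hα : 0 ≤ α) {c d : ι → ℝ} (hc : ∀ s, 0 ≤ c s) (hcd : ∀ s, c s ≤ d s) (hK : ∀ s, d s ≤ K) :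
    windowProb σ α c d ≤ (∏ s, (d s - c s)) / 2 ^ (n * Fintype.card ι)
      * ((√(overlap σ).det)⁻¹ * Real.exp (α ^ 2 / n * ∑ i, pairSum (fun s => σ s i)
        + 3 / 2 * Fintype.card ι ^ 2 * windowError n α K)) := by
  refine windowProb_le_of_densityRatio_le hn hσ hcd fun x hx => ?_
  refine mul_le_mul_of_nonneg_left (Real.exp_le_exp.mpr ?_) (by positivity)
  have hform := (abs_le.mp (abs_two_mul_dotProduct_sub_le hn σ hα
    (mem_Icc_of_mem_window hc hK hx))).1
  rw [windowError]
  linarith [le_dotProduct_inv_mulVec hσ x]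

lemma exp_pairSum_sub_overlapDefect_le_windowProb (hn : 0 < n) {σ : ι → Spin n} {ε : ℝ}
    (hσ : IsNearOrthogonal ε σ) (hε : Fintype.card ι * ε ≤ 1 / 2) {α K : ℝ} (hα : 0 ≤ α)
    (hK₀ : 0 ≤ K) {c d : ι → ℝ} (hc : ∀ s, 0 ≤ c s) (hcd : ∀ s, c s ≤ d s) (hK : ∀ s, d s ≤ K) :
    (∏ s, (d s - c s)) / 2 ^ (n * Fintype.card ι)
      * ((√(overlap σ).det)⁻¹ * Real.exp (α ^ 2 / n * ∑ i, pairSum (fun s => σ s i)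
        - Fintype.card ι * α ^ 2 * overlapDefect σ
        - (3 / 2 * Fintype.card ι ^ 2 + Fintype.card ι ^ 3) * windowError n α K))
      ≤ windowProb σ α c d := by
  have hQ := posDef_of_abs_sub_one_le (isHermitian_overlap σ) hσ hε
  refine le_windowProb_of_le_densityRatio hn hQ hcd fun x hx => ?_
  refine mul_le_mul_of_nonneg_left (Real.exp_le_exp.mpr ?_) (by positivity)
  have hxmem := mem_Icc_of_mem_window hc hK hx
  have hform := (abs_le.mp (abs_two_mul_dotProduct_sub_le hn σ hα hxmem)).2
  rw [← windowError] at hform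
  have hinv := dotProduct_inv_mulVec_le hQ (half_dotProduct_le_of_abs_sub_one_le hσ hε) x
  have hfrob := mulVec_dotProduct_mulVec_le (overlap σ - 1) x
  rw [← overlapDefect] at hfrob
  set D := overlapDefect σ
  set k := (Fintype.card ι : ℝ)
  have hη := windowError_nonneg hα hK₀ n
  have hself : x ⬝ᵥ x ≤ k * (α ^ 2 + windowError n α K) := by
    calc x ⬝ᵥ x ≤ ∑ _ : ι, (α + K * scaling n α) ^ 2 :=
          Finset.sum_le_sum fun s _ => by
            rw [← sq]
            exact pow_le_pow_left₀ (hα.trans (hxmem s).1) (hxmem s).2 2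
      _ = k * (α ^ 2 + windowError n α K) := by simp [windowError, k]
  have hdefect : D * (x ⬝ᵥ x) ≤ k * α ^ 2 * D + k ^ 3 * windowError n α K := by
    calc D * (x ⬝ᵥ x) ≤ D * (k * (α ^ 2 + windowError n α K)) :=
          mul_le_mul_of_nonneg_left hself (overlapDefect_nonneg σ)
      _ = k * α ^ 2 * D + D * (k * windowError n α K) := by ring
      _ ≤ k * α ^ 2 * D + k ^ 2 * (k * windowError n α K) := by
          gcongr
          exact overlapDefect_le_card_sq hn σ
      _ = _ := by ring
  linarith

end WindowProb

section RandomSigns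

open scoped BigOperators

variable {ι : Type*} [Fintype ι] [DecidableEq ι]

lemma expect_coe_units_mul_eq_zero {s : ι} {g : (ι → ℤˣ) → ℝ}
    (hg : ∀ y, g (Pi.mulSingle s (-1) * y) = g y) :
    𝔼 y : ι → ℤˣ, ((y s : ℤ) : ℝ) * g y = 0 := by
  have h : 𝔼 y : ι → ℤˣ, ((y s : ℤ) : ℝ) * g y = 𝔼 y : ι → ℤˣ, -(((y s : ℤ) : ℝ) * g y) :=
    Fintype.expect_equiv (Equiv.mulLeft (Pi.mulSingle s (-1 : ℤˣ))) _ _ fun y => by simp [hg]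
  rw [Finset.expect_neg_distrib] at h
  linarith

lemma sum_mulSingle_mul_eq {ι : Type*} [DecidableEq ι] {s : ι} {S : Finset ι} (hs : s ∉ S)
    (y : ι → ℤˣ) :
    ∑ t ∈ S, (((Pi.mulSingle s (-1) * y : ι → ℤˣ) t : ℤ) : ℝ) = ∑ t ∈ S, ((y t : ℤ) : ℝ) :=
  Finset.sum_congr rfl fun t ht => by
    simp [Pi.mulSingle_eq_of_ne (ne_of_mem_of_not_mem ht hs)]

lemma expect_sum_coe_units_sq (S : Finset ι) :
    𝔼 y : ι → ℤˣ, (∑ s ∈ S, ((y s : ℤ) : ℝ)) ^ 2 = S.card := by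
  induction S using Finset.induction_on with
  | empty => simp
  | insert s S hs ih =>
    have h (y : ι → ℤˣ) : (∑ t ∈ insert s S, ((y t : ℤ) : ℝ)) ^ 2
        = (∑ t ∈ S, ((y t : ℤ) : ℝ)) ^ 2 + 1
          + ((y s : ℤ) : ℝ) * (2 * ∑ t ∈ S, ((y t : ℤ) : ℝ)) := by
      rw [Finset.sum_insert hs]
      linear_combination coe_units_mul_self (y s)
    simp_rw [h]
    rw [Finset.expect_add_distrib, Finset.expect_add_distrib, ih,
      expect_coe_units_mul_eq_zero fun y => by rw [sum_mulSingle_mul_eq hs], Fintype.expect_const,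
      Finset.card_insert_of_notMem hs]
    push_cast
    ring

lemma expect_sum_coe_units_pow_four (S : Finset ι) :
    𝔼 y : ι → ℤˣ, (∑ s ∈ S, ((y s : ℤ) : ℝ)) ^ 4 = 3 * (S.card : ℝ) ^ 2 - 2 * S.card := by
  induction S using Finset.induction_on with
  | empty => simp
  | insert s S hs ih =>
    have h (y : ι → ℤˣ) : (∑ t ∈ insert s S, ((y t : ℤ) : ℝ)) ^ 4
        = (∑ t ∈ S, ((y t : ℤ) : ℝ)) ^ 4 + 6 * (∑ t ∈ S, ((y t : ℤ) : ℝ)) ^ 2 + 1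
          + ((y s : ℤ) : ℝ) * (4 * (∑ t ∈ S, ((y t : ℤ) : ℝ)) ^ 3
            + 4 * ∑ t ∈ S, ((y t : ℤ) : ℝ)) := by
      rw [Finset.sum_insert hs]
      linear_combination (((y s : ℤ) : ℝ) ^ 2 + 1
        + 6 * (∑ t ∈ S, ((y t : ℤ) : ℝ)) ^ 2 + 4 * (∑ t ∈ S, ((y t : ℤ) : ℝ)) * ((y s : ℤ) : ℝ))
        * coe_units_mul_self (y s)
    simp_rw [h]
    rw [Finset.expect_add_distrib, Finset.expect_add_distrib, Finset.expect_add_distrib, ih,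
      ← Finset.mul_expect, expect_sum_coe_units_sq,
      expect_coe_units_mul_eq_zero fun y => by rw [sum_mulSingle_mul_eq hs], Fintype.expect_const,
      Finset.card_insert_of_notMem hs]
    push_cast
    ring

lemma expect_pairSum : 𝔼 y : ι → ℤˣ, pairSum y = 0 := by
  simp only [pairSum, ← Finset.expect_div, Finset.expect_sub_distrib, expect_sum_coe_units_sq,
    Fintype.expect_const, Finset.card_univ, sub_self, zero_div]

lemma expect_pairSum_sq :
    𝔼 y : ι → ℤˣ, pairSum y ^ 2 = Fintype.card ι * (Fintype.card ι - 1) / 2 := by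
  have h (y : ι → ℤˣ) : pairSum y ^ 2 = (1 / 4) * (∑ s, ((y s : ℤ) : ℝ)) ^ 4
      - (Fintype.card ι / 2) * (∑ s, ((y s : ℤ) : ℝ)) ^ 2 + (Fintype.card ι : ℝ) ^ 2 / 4 := by
    rw [pairSum]
    ring
  simp_rw [h]
  rw [Finset.expect_add_distrib, Finset.expect_sub_distrib, ← Finset.mul_expect,
    ← Finset.mul_expect, expect_sum_coe_units_sq, expect_sum_coe_units_pow_four,
    Fintype.expect_const, Finset.card_univ]
  ring

/-- The moment generating function of `pairSum` under uniform random signs: each coordinate of the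
weights contributes one such factor to the sum over all tuples of spin configurations. -/
noncomputable def pairMGF (ι : Type*) [Fintype ι] [DecidableEq ι] (β : ℝ) : ℝ :=
  𝔼 y : ι → ℤˣ, Real.exp (β * pairSum y)

lemma one_le_pairMGF (β : ℝ) : 1 ≤ pairMGF ι β := by
  calc (1 : ℝ) = 𝔼 y : ι → ℤˣ, (β * pairSum y + 1) := by
        rw [Finset.expect_add_distrib, ← Finset.mul_expect, expect_pairSum, Fintype.expect_const]
        ring
    _ ≤ pairMGF ι β := Finset.expect_le_expect fun y _ => Real.add_one_le_exp _

lemma abs_mul_pairSum_le {ι : Type*} [Fintype ι] {β : ℝ} (hβ : 0 ≤ β) (y : ι → ℤˣ) :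
    |β * pairSum y| ≤ β * (Fintype.card ι : ℝ) ^ 2 := by
  rw [abs_mul, abs_of_nonneg hβ]
  exact mul_le_mul_of_nonneg_left (abs_pairSum_le y) hβ

lemma abs_expect_units_le {f : (ι → ℤˣ) → ℝ} {c : ℝ} (h : ∀ y, |f y| ≤ c) :
    |𝔼 y, f y| ≤ c :=
  (Finset.abs_expect_le _ _).trans (Finset.expect_le Finset.univ_nonempty fun y _ => h y)

lemma abs_exp_sub_quadratic_le {x : ℝ} (hx : |x| ≤ 1) :
    |Real.exp x - (1 + x + x ^ 2 / 2)| ≤ |x| ^ 3 := by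
  have h := Real.exp_bound hx (n := 3) (by norm_num)
  norm_num [Finset.sum_range_succ, Nat.factorial] at h
  linarith [pow_nonneg (abs_nonneg x) 3]

lemma abs_pairMGF_sub_le {β : ℝ} (hβ : 0 ≤ β) (hβ1 : β * (Fintype.card ι : ℝ) ^ 2 ≤ 1) :
    |pairMGF ι β - (1 + Fintype.card ι * (Fintype.card ι - 1) / 4 * β ^ 2)|
      ≤ (Fintype.card ι : ℝ) ^ 6 * β ^ 3 := by
  have h : 𝔼 y : ι → ℤˣ, (1 + β * pairSum y + (β * pairSum y) ^ 2 / 2)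
      = 1 + Fintype.card ι * (Fintype.card ι - 1) / 4 * β ^ 2 := by
    simp_rw [mul_pow, mul_div_right_comm]
    rw [Finset.expect_add_distrib, Finset.expect_add_distrib, ← Finset.mul_expect,
      ← Finset.mul_expect, expect_pairSum, expect_pairSum_sq, Fintype.expect_const]
    ring
  rw [← h, pairMGF, ← Finset.expect_sub_distrib]
  refine abs_expect_units_le fun y => ?_
  have hy := abs_mul_pairSum_le hβ y
  calc _ ≤ |β * pairSum y| ^ 3 := abs_exp_sub_quadratic_le (hy.trans hβ1)
    _ ≤ (β * (Fintype.card ι : ℝ) ^ 2) ^ 3 := pow_le_pow_left₀ (abs_nonneg _) hy 3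
    _ = _ := by ring

lemma pairMGF_le_exp {β : ℝ} (hβ : 0 ≤ β) (hβ1 : β * (Fintype.card ι : ℝ) ^ 2 ≤ 1) :
    pairMGF ι β ≤ Real.exp (Fintype.card ι * (Fintype.card ι - 1) / 4 * β ^ 2
      + (Fintype.card ι : ℝ) ^ 6 * β ^ 3) := by
  have h := (abs_le.mp (abs_pairMGF_sub_le hβ hβ1)).2
  refine le_trans ?_ (Real.add_one_le_exp _)
  linarith

lemma exp_sub_two_mul_sq_le {z : ℝ} (hz : |z| ≤ 1 / 2) : Real.exp (z - 2 * z ^ 2) ≤ 1 + z := by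
  have hz1 : 0 < 1 + z := by linarith [(abs_le.mp hz).1]
  rw [← Real.le_log_iff_exp_le hz1]
  refine le_trans ?_ (Real.one_sub_inv_le_log_of_pos hz1)
  rw [le_sub_iff_add_le, ← le_sub_iff_add_le', inv_le_iff_one_le_mul₀' hz1]
  nlinarith [sq_nonneg z, (abs_le.mp hz).1]

lemma exp_le_pairMGF {β : ℝ} (hβ : 0 ≤ β) (hβ1 : β * (Fintype.card ι : ℝ) ^ 2 ≤ 1 / 2) :
    Real.exp (Fintype.card ι * (Fintype.card ι - 1) / 4 * β ^ 2
      - 2 * (Fintype.card ι : ℝ) ^ 6 * β ^ 3) ≤ pairMGF ι β := by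
  have hMGF := (abs_le.mp (abs_pairMGF_sub_le hβ (hβ1.trans (by norm_num)))).1
  have hk2 : (Fintype.card ι : ℝ) ≤ (Fintype.card ι : ℝ) ^ 2 := by
    exact_mod_cast Nat.le_self_pow two_ne_zero (Fintype.card ι)
  set k : ℝ := (Fintype.card ι : ℝ)
  have hk : 0 ≤ k := Nat.cast_nonneg _
  obtain ⟨w, hw⟩ : ∃ w, w = β * k ^ 2 := ⟨_, rfl⟩
  have hw0 : 0 ≤ w := hw ▸ by positivity
  have hcubic : k ^ 6 * β ^ 3 = w ^ 3 := by rw [hw]; ring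
  have hquad : k * (k - 1) / 4 * β ^ 2 ≤ w ^ 2 / 4 := by
    have : k * (k - 1) ≤ (k ^ 2) ^ 2 := by nlinarith [mul_self_le_mul_self hk hk2]
    rw [hw]
    nlinarith [mul_le_mul_of_nonneg_right this (sq_nonneg β)]
  have hquad0 : 0 ≤ k * (k - 1) / 4 * β ^ 2 := mul_nonneg (by linarith) (sq_nonneg β)
  rw [← hw] at hβ1
  have hw3 : w ^ 3 ≤ w ^ 2 / 2 := by nlinarith [mul_le_mul_of_nonneg_left hβ1 (sq_nonneg w)]
  obtain ⟨z, hz⟩ : ∃ z, z = k * (k - 1) / 4 * β ^ 2 - w ^ 3 := ⟨_, rfl⟩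
  have hzw : |z| ≤ w ^ 2 / 2 :=
    abs_le.mpr ⟨by linarith, by linarith [pow_nonneg hw0 3, sq_nonneg w]⟩
  have hz1 : |z| ≤ 1 / 2 := hzw.trans (by nlinarith)
  have hz2 : 2 * z ^ 2 ≤ w ^ 3 := by
    rw [← sq_abs]
    nlinarith [pow_le_pow_left₀ (abs_nonneg z) hzw 2,
      mul_le_mul_of_nonneg_left hβ1 (pow_nonneg hw0 3), pow_nonneg hw0 3]
  calc _ ≤ Real.exp (z - 2 * z ^ 2) := Real.exp_le_exp.mpr (by linarith)
    _ ≤ 1 + z := exp_sub_two_mul_sq_le hz1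
    _ ≤ pairMGF ι β := by linarith

lemma expect_coe_units_mul_coe_units {s t : ι} (hst : s ≠ t) :
    𝔼 y : ι → ℤˣ, ((y s : ℤ) : ℝ) * ((y t : ℤ) : ℝ) = 0 :=
  expect_coe_units_mul_eq_zero fun y => by simp [Pi.mulSingle_eq_of_ne hst.symm]

lemma abs_expect_mul_exp_pairSum_le {s t : ι} (hst : s ≠ t) {β : ℝ} (hβ : 0 ≤ β)
    (hβ1 : β * (Fintype.card ι : ℝ) ^ 2 ≤ 1) :
    |𝔼 y : ι → ℤˣ, ((y s : ℤ) : ℝ) * ((y t : ℤ) : ℝ) * Real.exp (β * pairSum y)|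
      ≤ 2 * β * (Fintype.card ι : ℝ) ^ 2 := by
  have h : 𝔼 y : ι → ℤˣ, ((y s : ℤ) : ℝ) * ((y t : ℤ) : ℝ) * Real.exp (β * pairSum y)
      = 𝔼 y : ι → ℤˣ, ((y s : ℤ) : ℝ) * ((y t : ℤ) : ℝ) * (Real.exp (β * pairSum y) - 1) := by
    simp_rw [mul_sub_one]
    rw [Finset.expect_sub_distrib, expect_coe_units_mul_coe_units hst, sub_zero]
  rw [h]
  refine abs_expect_units_le fun y => ?_
  have hy := abs_mul_pairSum_le hβ y
  rw [abs_mul, abs_mul, abs_coe_units, abs_coe_units, one_mul, one_mul]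
  linarith [Real.abs_exp_sub_one_le (hy.trans hβ1)]

lemma exp_mul_coe_units (θ : ℝ) (u : ℤˣ) :
    Real.exp (θ * ((u : ℤ) : ℝ)) = Real.cosh θ + Real.sinh θ * ((u : ℤ) : ℝ) := by
  rcases Int.units_eq_one_or u with rfl | rfl
  · simp [Real.cosh_add_sinh]
  · simp [← sub_eq_add_neg, Real.cosh_sub_sinh]

lemma expect_exp_mul_coe_units_le {s t : ι} (hst : s ≠ t) (θ : ℝ) :
    𝔼 y : ι → ℤˣ, Real.exp (θ * (((y s : ℤ) : ℝ) * ((y t : ℤ) : ℝ))) ≤ Real.exp (θ ^ 2 / 2) := by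
  have h (y : ι → ℤˣ) : Real.exp (θ * (((y s : ℤ) : ℝ) * ((y t : ℤ) : ℝ)))
      = Real.cosh θ + Real.sinh θ * (((y s : ℤ) : ℝ) * ((y t : ℤ) : ℝ)) := by
    simpa using exp_mul_coe_units θ (y s * y t)
  simp_rw [h]
  rw [Finset.expect_add_distrib, Fintype.expect_const, ← Finset.mul_expect,
    expect_coe_units_mul_coe_units hst, mul_zero, add_zero]
  exact Real.cosh_le_exp_half_sq θ

end RandomSigns

section RandomTuples

open scoped BigOperators

variable {ι : Type*} [Fintype ι] [DecidableEq ι] {n : ℕ}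

lemma expect_prod_sites (f : Fin n → (ι → ℤˣ) → ℝ) :
    𝔼 σ : ι → Spin n, ∏ i, f i (fun s => σ s i) = ∏ i, 𝔼 y, f i y := by
  simp only [Fintype.expect_eq_sum_div_card, Finset.prod_div_distrib, Finset.prod_univ_sum,
    Fintype.piFinset_univ]
  congr 1
  · exact Fintype.sum_equiv (Equiv.piComm fun _ _ => ℤˣ) _ _ fun σ => rfl
  · simp [Spin, ← pow_mul, mul_comm]

lemma expect_exp_sum_pairSum (β : ℝ) :
    𝔼 σ : ι → Spin n, Real.exp (β * ∑ i, pairSum fun s => σ s i) = pairMGF ι β ^ n := by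
  simp_rw [Finset.mul_sum, Real.exp_sum]
  rw [expect_prod_sites fun _ y => Real.exp (β * pairSum y), Finset.prod_const, Finset.card_univ,
    Fintype.card_fin, pairMGF]

lemma expect_exp_mul_overlap_le (hn : 0 < n) {s t : ι} (hst : s ≠ t) (θ : ℝ) :
    𝔼 σ : ι → Spin n, Real.exp (θ * (n * overlap σ s t)) ≤ Real.exp (n * (θ ^ 2 / 2)) := by
  have h (σ : ι → Spin n) : Real.exp (θ * (n * overlap σ s t))
      = ∏ i, Real.exp (θ * (((σ s i : ℤ) : ℝ) * ((σ t i : ℤ) : ℝ))) := by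
    rw [← Real.exp_sum, overlap_apply, mul_div_cancel₀ _ (by positivity), Finset.mul_sum]
  simp_rw [h]
  rw [expect_prod_sites fun _ y => Real.exp (θ * (((y s : ℤ) : ℝ) * ((y t : ℤ) : ℝ))),
    Finset.prod_const, Finset.card_univ, Fintype.card_fin, Real.exp_nat_mul]
  exact pow_le_pow_left₀ (Finset.expect_nonneg fun y _ => (Real.exp_pos _).le)
    (expect_exp_mul_coe_units_le hst θ) n

lemma expect_indicator_lt_abs_overlap_le (hn : 0 < n) {s t : ι} (hst : s ≠ t) {ε : ℝ}
    (hε : 0 ≤ ε) :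
    𝔼 σ : ι → Spin n, Set.indicator {σ | ε < |overlap σ s t|} 1 σ
      ≤ 2 * Real.exp (-(n * ε ^ 2 / 2)) := by
  have hMarkov (σ : ι → Spin n) : Set.indicator {σ | ε < |overlap σ s t|} (1 : (ι → Spin n) → ℝ) σ
      ≤ Real.exp (-(n * ε ^ 2)) * (Real.exp (ε * (n * overlap σ s t))
        + Real.exp (-ε * (n * overlap σ s t))) := by
    refine Set.indicator_apply_le' (fun hσ => ?_) (fun _ => by positivity)
    rw [Pi.one_apply]
    rw [mul_add, ← Real.exp_add, ← Real.exp_add]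
    have hnε : 0 ≤ n * ε := by positivity
    rw [Set.mem_ofPred_eq, lt_abs] at hσ
    rcases hσ with h | h
    · refine le_add_of_le_of_nonneg (Real.one_le_exp ?_) (Real.exp_pos _).le
      nlinarith [mul_nonneg hnε (sub_nonneg.mpr h.le)]
    · refine le_add_of_nonneg_of_le (Real.exp_pos _).le (Real.one_le_exp ?_)
      nlinarith [mul_nonneg hnε (sub_nonneg.mpr h.le)]
  have hpos := expect_exp_mul_overlap_le hn hst ε
  have hneg := expect_exp_mul_overlap_le hn hst (-ε)
  rw [neg_sq] at hneg
  calc _ ≤ Real.exp (-(n * ε ^ 2)) * (Real.exp (n * (ε ^ 2 / 2)) + Real.exp (n * (ε ^ 2 / 2))) := by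
        refine (Finset.expect_le_expect fun σ _ => hMarkov σ).trans ?_
        rw [← Finset.mul_expect, Finset.expect_add_distrib]
        gcongr
    _ = _ := by
        rw [← two_mul, mul_left_comm, ← Real.exp_add]
        ring_nf

lemma expect_indicator_not_isNearOrthogonal_le (hn : 0 < n) {ε : ℝ} (hε : 0 ≤ ε) :
    𝔼 σ : ι → Spin n, Set.indicator {σ | ¬ IsNearOrthogonal ε σ} 1 σ
      ≤ (Fintype.card ι : ℝ) ^ 2 * (2 * Real.exp (-(n * ε ^ 2 / 2))) := by
  have hunion (σ : ι → Spin n) : Set.indicator {σ | ¬ IsNearOrthogonal ε σ} (1 : (ι → Spin n) → ℝ) σ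
      ≤ ∑ s, ∑ t, Set.indicator {σ | ε < |(overlap σ - 1) s t|} 1 σ := by
    have hnonneg (s t : ι) :
        0 ≤ Set.indicator {σ | ε < |(overlap σ - 1) s t|} (1 : (ι → Spin n) → ℝ) σ :=
      Set.indicator_nonneg (fun _ _ => zero_le_one) σ
    refine Set.indicator_apply_le' (fun hσ => ?_) (fun _ => Finset.sum_nonneg fun s _ =>
      Finset.sum_nonneg fun t _ => hnonneg s t)
    simp only [IsNearOrthogonal, Set.mem_ofPred_eq, not_forall, not_le] at hσ
    obtain ⟨s, t, hst⟩ := hσ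
    calc (1 : ℝ) = Set.indicator {σ | ε < |(overlap σ - 1) s t|} 1 σ :=
          (Set.indicator_of_mem (s := {σ | ε < |(overlap σ - 1) s t|}) hst 1).symm
      _ ≤ ∑ t, Set.indicator {σ | ε < |(overlap σ - 1) s t|} 1 σ :=
          Finset.single_le_sum (fun t _ => hnonneg s t) (Finset.mem_univ t)
      _ ≤ _ := Finset.single_le_sum
          (f := fun s =>
            ∑ t, Set.indicator {σ | ε < |(overlap σ - 1) s t|} (1 : (ι → Spin n) → ℝ) σ)
          (fun s _ => Finset.sum_nonneg fun t _ => hnonneg s t) (Finset.mem_univ s)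
  have hpair (s t : ι) : 𝔼 σ : ι → Spin n, Set.indicator {σ | ε < |(overlap σ - 1) s t|} 1 σ
      ≤ 2 * Real.exp (-(n * ε ^ 2 / 2)) := by
    rcases eq_or_ne s t with rfl | hst
    · simp only [Matrix.sub_apply, overlap_self hn, Matrix.one_apply_eq, sub_self, abs_zero,
        not_lt.mpr hε, Set.ofPred_false, Set.indicator_empty, Finset.expect_const_zero]
      positivity
    · simpa only [Matrix.sub_apply, Matrix.one_apply_ne hst, sub_zero] using
        expect_indicator_lt_abs_overlap_le hn hst hε
  calc _ ≤ ∑ s, ∑ t, 𝔼 σ : ι → Spin n, Set.indicator {σ | ε < |(overlap σ - 1) s t|} 1 σ := by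
        refine (Finset.expect_le_expect fun σ _ => hunion σ).trans_eq ?_
        simp_rw [Finset.expect_sum_comm]
    _ ≤ ∑ _ : ι, ∑ _ : ι, 2 * Real.exp (-(n * ε ^ 2 / 2)) :=
        Finset.sum_le_sum fun s _ => Finset.sum_le_sum fun t _ => hpair s t
    _ = _ := by
        simp only [Finset.sum_const, Finset.card_univ, nsmul_eq_mul]
        ring

/-- The density, with respect to uniform signs, of the probability weights on sign patterns tilted
by `exp (β * pairSum)`. -/
noncomputable def tiltedWeight (β : ℝ) (y : ι → ℤˣ) : ℝ :=
  Real.exp (β * pairSum y) / pairMGF ι β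

/-- The product over the sites of the tilted weights: under these weights the sites of a tuple are
independent. -/
noncomputable def tupleWeight (β : ℝ) (σ : ι → Spin n) : ℝ :=
  ∏ i, tiltedWeight β fun s => σ s i

lemma pairMGF_pos (β : ℝ) : 0 < pairMGF ι β :=
  one_pos.trans_le (one_le_pairMGF β)

lemma tupleWeight_nonneg (β : ℝ) (σ : ι → Spin n) : 0 ≤ tupleWeight β σ :=
  Finset.prod_nonneg fun _ _ => div_nonneg (Real.exp_pos _).le (pairMGF_pos β).le

lemma exp_sum_pairSum_eq (β : ℝ) (σ : ι → Spin n) :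
    Real.exp (β * ∑ i, pairSum fun s => σ s i) = pairMGF ι β ^ n * tupleWeight β σ := by
  simp only [tupleWeight, tiltedWeight, Finset.prod_div_distrib, Finset.prod_const,
    Finset.card_univ, Fintype.card_fin]
  rw [mul_div_cancel₀ _ (pow_pos (pairMGF_pos β) n).ne', ← Real.exp_sum, Finset.mul_sum]

lemma expect_tiltedWeight (β : ℝ) : 𝔼 y : ι → ℤˣ, tiltedWeight β y = 1 := by
  simp only [tiltedWeight, ← Finset.expect_div]
  exact div_self (pairMGF_pos β).ne'

lemma expect_tupleWeight (β : ℝ) : 𝔼 σ : ι → Spin n, tupleWeight β σ = 1 := by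
  simp only [tupleWeight]
  rw [expect_prod_sites fun _ => tiltedWeight β]
  simp only [expect_tiltedWeight, Finset.prod_const_one]

lemma expect_tupleWeight_mul_mul (β : ℝ) {i j : Fin n} (hij : i ≠ j) (f : (ι → ℤˣ) → ℝ) :
    𝔼 σ : ι → Spin n, tupleWeight β σ * (f (fun s => σ s i) * f (fun s => σ s j))
      = (𝔼 y, tiltedWeight β y * f y) ^ 2 := by
  have h (σ : ι → Spin n) : tupleWeight β σ * (f (fun s => σ s i) * f (fun s => σ s j))
      = ∏ l, tiltedWeight β (fun s => σ s l)
        * if l = i ∨ l = j then f (fun s => σ s l) else 1 := by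
    rw [Finset.prod_mul_distrib, tupleWeight]
    congr 1
    rw [Fintype.prod_eq_mul i j hij (fun l hl => if_neg (by tauto))]
    simp
  simp_rw [h]
  rw [expect_prod_sites fun l y => tiltedWeight β y * if l = i ∨ l = j then f y else 1,
    Fintype.prod_eq_mul i j hij fun l hl => by
      simp only [hl.1, hl.2, or_self, if_false, mul_one, expect_tiltedWeight]]
  simp [sq]

lemma abs_expect_tiltedWeight_mul_le {s t : ι} (hst : s ≠ t) {β : ℝ} (hβ : 0 ≤ β)
    (hβ1 : β * (Fintype.card ι : ℝ) ^ 2 ≤ 1) :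
    |𝔼 y : ι → ℤˣ, tiltedWeight β y * (((y s : ℤ) : ℝ) * ((y t : ℤ) : ℝ))|
      ≤ 2 * β * (Fintype.card ι : ℝ) ^ 2 := by
  have h (y : ι → ℤˣ) : tiltedWeight β y * (((y s : ℤ) : ℝ) * ((y t : ℤ) : ℝ))
      = ((y s : ℤ) : ℝ) * ((y t : ℤ) : ℝ) * Real.exp (β * pairSum y) / pairMGF ι β := by
    rw [tiltedWeight]
    ring
  simp_rw [h]
  rw [← Finset.expect_div, abs_div, abs_of_pos (pairMGF_pos β)]
  exact (div_le_self (abs_nonneg _) (one_le_pairMGF β)).trans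
    (abs_expect_mul_exp_pairSum_le hst hβ hβ1)

lemma expect_tupleWeight_mul_overlap_sq_le (hn : 0 < n) {s t : ι} (hst : s ≠ t) {β : ℝ}
    (hβ : 0 ≤ β) (hβ1 : β * (Fintype.card ι : ℝ) ^ 2 ≤ 1) :
    𝔼 σ : ι → Spin n, tupleWeight β σ * overlap σ s t ^ 2
      ≤ 1 / n + 4 * β ^ 2 * (Fintype.card ι : ℝ) ^ 4 := by
  set f : (ι → ℤˣ) → ℝ := fun y => ((y s : ℤ) : ℝ) * ((y t : ℤ) : ℝ)
  set b : ℝ := 4 * β ^ 2 * (Fintype.card ι : ℝ) ^ 4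
  have hexpand (σ : ι → Spin n) : tupleWeight β σ * overlap σ s t ^ 2
      = (∑ i, ∑ j, tupleWeight β σ * (f (fun s => σ s i) * f (fun s => σ s j))) / (n : ℝ) ^ 2 := by
    rw [overlap_apply, div_pow, ← mul_div_assoc, sq, Finset.sum_mul_sum]
    simp only [Finset.mul_sum, f]
  have hterm (i j : Fin n) :
      𝔼 σ : ι → Spin n, tupleWeight β σ * (f (fun s => σ s i) * f (fun s => σ s j))
        ≤ (if i = j then 1 else 0) + b := by
    rcases eq_or_ne i j with rfl | hij
    · have hone (σ : ι → Spin n) : f (fun s => σ s i) * f (fun s => σ s i) = 1 := by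
        simp only [f]
        rw [mul_mul_mul_comm, coe_units_mul_self, coe_units_mul_self, one_mul]
      simp only [hone, mul_one, expect_tupleWeight, if_true, le_add_iff_nonneg_right]
      positivity
    · rw [expect_tupleWeight_mul_mul β hij, if_neg hij, zero_add, ← sq_abs]
      refine (pow_le_pow_left₀ (abs_nonneg _)
        (abs_expect_tiltedWeight_mul_le hst hβ hβ1) 2).trans_eq ?_
      ring
  simp_rw [hexpand]
  rw [← Finset.expect_div, div_le_iff₀ (by positivity)]
  simp_rw [Finset.expect_sum_comm]
  calc _ ≤ ∑ i : Fin n, ∑ j : Fin n, ((if i = j then 1 else 0) + b) :=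
        Finset.sum_le_sum fun i _ => Finset.sum_le_sum fun j _ => hterm i j
    _ = n + n * (n * b) := by simp [Finset.sum_add_distrib]
    _ = _ := by field_simp

lemma expect_tupleWeight_mul_overlapDefect_le (hn : 0 < n) {β : ℝ} (hβ : 0 ≤ β)
    (hβ1 : β * (Fintype.card ι : ℝ) ^ 2 ≤ 1) :
    𝔼 σ : ι → Spin n, tupleWeight β σ * overlapDefect σ
      ≤ (Fintype.card ι : ℝ) ^ 2 * (1 / n + 4 * β ^ 2 * (Fintype.card ι : ℝ) ^ 4) := by
  have hterm (s t : ι) : 𝔼 σ : ι → Spin n, tupleWeight β σ * (overlap σ - 1) s t ^ 2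
      ≤ 1 / n + 4 * β ^ 2 * (Fintype.card ι : ℝ) ^ 4 := by
    rcases eq_or_ne s t with rfl | hst
    · simp only [Matrix.sub_apply, overlap_self hn, Matrix.one_apply_eq, sub_self, ne_eq,
        two_ne_zero, not_false_eq_true, zero_pow, mul_zero, Finset.expect_const_zero]
      positivity
    · simpa only [Matrix.sub_apply, Matrix.one_apply_ne hst, sub_zero] using
        expect_tupleWeight_mul_overlap_sq_le hn hst hβ hβ1
  simp only [overlapDefect, Finset.mul_sum, Finset.expect_sum_comm]
  refine (Finset.sum_le_sum fun s _ => Finset.sum_le_sum fun t _ => hterm s t).trans_eq ?_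
  simp only [Finset.sum_const, Finset.card_univ, nsmul_eq_mul]
  ring

-- Outside the near-orthogonal tuples the defect exceeds `ε ^ 2`, so the left side is negative
-- there; inside, it lies below the tangent line of `exp` at `v`.
lemma exp_mul_le_indicator_isNearOrthogonal {c v ε : ℝ} (hc : 0 ≤ c) (hε : 0 < ε)
    (hv : v ≤ ε ^ 2) (σ : ι → Spin n) :
    Real.exp (-(c * v)) * (1 + c * v - (c + 1 / ε ^ 2) * overlapDefect σ)
      ≤ Set.indicator {σ | IsNearOrthogonal ε σ}
        (fun σ => Real.exp (-(c * overlapDefect σ))) σ := by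
  have hD := overlapDefect_nonneg σ
  by_cases hσ : IsNearOrthogonal ε σ
  · rw [Set.indicator_of_mem hσ, ← le_div_iff₀' (Real.exp_pos _), ← Real.exp_sub]
    refine le_trans ?_ (Real.add_one_le_exp _)
    have : 0 ≤ 1 / ε ^ 2 * overlapDefect σ := by positivity
    linarith
  · rw [Set.indicator_of_notMem hσ]
    have hDε : ε ^ 2 < overlapDefect σ :=
      lt_of_not_ge fun h => hσ (isNearOrthogonal_of_overlapDefect_le hε.le h)
    refine mul_nonpos_of_nonneg_of_nonpos (Real.exp_pos _).le ?_
    have h1 : 1 ≤ 1 / ε ^ 2 * overlapDefect σ := by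
      rw [one_div, ← div_eq_inv_mul, one_le_div (by positivity)]
      exact hDε.le
    linarith [mul_le_mul_of_nonneg_left (hv.trans hDε.le) hc]

lemma le_expect_indicator_isNearOrthogonal (hn : 0 < n) {β c ε v : ℝ} (hβ : 0 ≤ β)
    (hβ1 : β * (Fintype.card ι : ℝ) ^ 2 ≤ 1) (hc : 0 ≤ c) (hε : 0 < ε) (hv : v ≤ ε ^ 2)
    (hdef : (Fintype.card ι : ℝ) ^ 2 * (1 / n + 4 * β ^ 2 * (Fintype.card ι : ℝ) ^ 4) ≤ v) :
    pairMGF ι β ^ n * ((1 - v / ε ^ 2) * Real.exp (-(c * v)))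
      ≤ 𝔼 σ : ι → Spin n, Set.indicator {σ | IsNearOrthogonal ε σ}
        (fun σ => Real.exp (β * (∑ i, pairSum fun s => σ s i) - c * overlapDefect σ)) σ := by
  have hfactor (σ : ι → Spin n) : Set.indicator {σ | IsNearOrthogonal ε σ}
        (fun σ => Real.exp (β * (∑ i, pairSum fun s => σ s i) - c * overlapDefect σ)) σ
      = pairMGF ι β ^ n * (tupleWeight β σ * Set.indicator {σ | IsNearOrthogonal ε σ}
        (fun σ => Real.exp (-(c * overlapDefect σ))) σ) := by
    by_cases hσ : IsNearOrthogonal ε σ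
    · simp only [Set.indicator_of_mem (s := {σ | IsNearOrthogonal ε σ}) hσ]
      rw [sub_eq_add_neg, Real.exp_add, exp_sum_pairSum_eq, mul_assoc]
    · simp only [Set.indicator_of_notMem (s := {σ | IsNearOrthogonal ε σ}) hσ, mul_zero]
  simp_rw [hfactor]
  rw [← Finset.mul_expect]
  refine mul_le_mul_of_nonneg_left ?_ (pow_nonneg (pairMGF_pos β).le n)
  refine le_trans ?_ (Finset.expect_le_expect fun σ _ => mul_le_mul_of_nonneg_left
    (exp_mul_le_indicator_isNearOrthogonal hc hε hv σ) (tupleWeight_nonneg β σ))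
  have hmean : 𝔼 σ : ι → Spin n, tupleWeight β σ
        * (Real.exp (-(c * v)) * (1 + c * v - (c + 1 / ε ^ 2) * overlapDefect σ))
      = Real.exp (-(c * v)) * (1 + c * v
        - (c + 1 / ε ^ 2) * 𝔼 σ : ι → Spin n, tupleWeight β σ * overlapDefect σ) := by
    have h (σ : ι → Spin n) : tupleWeight β σ
        * (Real.exp (-(c * v)) * (1 + c * v - (c + 1 / ε ^ 2) * overlapDefect σ))
        = Real.exp (-(c * v)) * (1 + c * v) * tupleWeight β σ
          - Real.exp (-(c * v)) * (c + 1 / ε ^ 2) * (tupleWeight β σ * overlapDefect σ) := by ring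
    simp_rw [h]
    rw [Finset.expect_sub_distrib, ← Finset.mul_expect, ← Finset.mul_expect, expect_tupleWeight]
    ring
  rw [hmean, mul_comm (1 - _)]
  refine mul_le_mul_of_nonneg_left ?_ (Real.exp_pos _).le
  have hE := (expect_tupleWeight_mul_overlapDefect_le (ι := ι) hn hβ hβ1).trans hdef
  have := mul_le_mul_of_nonneg_left hE (by positivity : 0 ≤ c + 1 / ε ^ 2)
  rw [div_eq_mul_one_div, mul_comm v]
  linarith

end RandomTuples

section DependentTuples

open Matrix

lemma exists_eq_single_of_abs_sum_eq_one {ι : Type*} {J : Finset ι} {c : ι → ℝ}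
    (h : ∀ p : ι → ℤˣ, |∑ j ∈ J, c j * ((p j : ℤ) : ℝ)| = 1) :
    ∃ j₀ ∈ J, (c j₀ = 1 ∨ c j₀ = -1) ∧ ∀ j ∈ J, j ≠ j₀ → c j = 0 := by
  classical
  obtain ⟨p, hp⟩ : ∃ p : ι → ℤˣ, ∀ j, c j * ((p j : ℤ) : ℝ) = |c j| := by
    refine ⟨fun j => if 0 ≤ c j then 1 else -1, fun j => ?_⟩
    by_cases hj : 0 ≤ c j
    · simp [hj, abs_of_nonneg hj]
    · simp [hj, abs_of_neg (not_le.mp hj)]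
  have hsum : ∑ j ∈ J, |c j| = 1 := by
    have := h p
    simp only [hp] at this
    rwa [abs_of_nonneg (Finset.sum_nonneg fun j _ => abs_nonneg _)] at this
  obtain ⟨j₀, hj₀, hc⟩ : ∃ j ∈ J, c j ≠ 0 := by
    by_contra! hc
    simp [Finset.sum_congr rfl fun j hj => congrArg abs (hc j hj)] at hsum
  have hflip : |(∑ j ∈ J, |c j|) - 2 * (|c j₀|)| = 1 := by
    have herase : ∀ j ∈ J.erase j₀, c j * ((Function.update p j₀ (-p j₀) j : ℤ) : ℝ) = |c j| :=
      fun j hj => by rw [Function.update_of_ne (Finset.ne_of_mem_erase hj), hp]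
    rw [← h (Function.update p j₀ (-p j₀)), ← Finset.add_sum_erase _ _ hj₀,
      ← Finset.add_sum_erase _ _ hj₀, Finset.sum_congr rfl herase, Function.update_self,
      Units.val_neg, Int.cast_neg, mul_neg, hp]
    ring_nf
  have habs : |c j₀| = 1 := by
    have := abs_pos.mpr hc
    rw [hsum] at hflip
    rcases (abs_eq zero_le_one).mp hflip with h | h <;> linarith
  refine ⟨j₀, hj₀, (abs_eq zero_le_one).mp habs, fun j hj hne => ?_⟩
  rw [← Finset.add_sum_erase _ _ hj₀, habs, add_eq_left,
    Finset.sum_eq_zero_iff_of_nonneg fun j _ => abs_nonneg _] at hsum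
  exact abs_eq_zero.mp (hsum j (Finset.mem_erase.mpr ⟨hne, hj⟩))

lemma coe_units_injective : Function.Injective fun u : ℤˣ => ((u : ℤ) : ℝ) :=
  Int.cast_injective.comp Units.val_injective

variable {ι : Type*} {n : ℕ}

/-- The configurations of the tuple represent pairwise distinct partitions: they are distinct even
up to a global flip. -/
def PairwiseNonparallel (σ : ι → Spin n) : Prop :=
  Pairwise fun s t => σ s ≠ σ t ∧ σ s ≠ -σ t

lemma windowProb_le_of_subtuple (hn : 0 < n) {σ : ι → Spin n} {J : Finset ι}
    (hJ : LinearIndependent ℝ (signMatrix fun j : J => σ j).row) {α : ℝ} {c d : ι → ℝ}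
    (hcd : ∀ s, c s ≤ d s) :
    windowProb σ α c d ≤ (∏ s ∈ J, (d s - c s)) / 2 ^ (n * J.card)
      * (√n ^ J.card * Real.exp (J.card * α ^ 2 / 2)) := by
  classical
  refine (windowProb_le_comp_val σ α c d J).trans ?_
  have h := windowProb_le_of_linearIndependent hn hJ (α := α) (c := fun j : J => c j)
    (d := fun j => d j) fun j => hcd j
  rwa [Finset.prod_coe_sort J fun s => d s - c s, Fintype.card_coe] at h

variable [Fintype ι]

omit [Fintype ι] in
lemma exists_linearIndependent_subtuple [Finite ι] (σ : ι → Spin n) :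
    ∃ J : Finset ι, LinearIndependent ℝ (signMatrix fun j : J => σ j).row ∧
      ∀ s, ∃ c : ι → ℝ, ∀ i, ∑ j ∈ J, c j * ((σ j i : ℤ) : ℝ) = ((σ s i : ℤ) : ℝ) := by
  classical
  obtain ⟨b, -, -, hspan, hli⟩ := exists_linearIndepOn_extension (K := ℝ)
    (v := (signMatrix σ).row) (linearIndepOn_empty ℝ _) (Set.empty_subset Set.univ)
  lift b to Finset ι using b.toFinite
  refine ⟨b, hli, fun s => ?_⟩
  obtain ⟨c, hc⟩ := (Submodule.mem_span_image_finset_iff_exists_fun' ℝ).mp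
    (hspan ⟨s, Set.mem_univ s, rfl⟩)
  exact ⟨c, fun i => by simpa [signMatrix] using congrFun hc i⟩

lemma exists_missing_pattern {σ : ι → Spin n} (hσ : PairwiseNonparallel σ)
    {J : Finset ι} (hJ : J ≠ Finset.univ)
    (hspan : ∀ s, ∃ c : ι → ℝ, ∀ i, ∑ j ∈ J, c j * ((σ j i : ℤ) : ℝ) = ((σ s i : ℤ) : ℝ)) :
    ∃ p : ι → ℤˣ, ∀ i, ∃ j ∈ J, σ j i ≠ p j := by
  by_contra! hall
  obtain ⟨s, hs⟩ : ∃ s, s ∉ J := by simpa [Finset.eq_univ_iff_forall] using hJ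
  obtain ⟨c, hc⟩ := hspan s
  obtain ⟨j₀, hj₀, hc₀, hc'⟩ := exists_eq_single_of_abs_sum_eq_one (J := J) (c := c) fun p => by
    obtain ⟨i, hi⟩ := hall p
    rw [← abs_coe_units (σ s i), ← hc]
    exact congrArg _ (Finset.sum_congr rfl fun j hj => by rw [hi j hj])
  have hval : ∀ i, ((σ s i : ℤ) : ℝ) = c j₀ * ((σ j₀ i : ℤ) : ℝ) := fun i => by
    rw [← hc, Finset.sum_eq_single_of_mem j₀ hj₀ fun j hj hne => by rw [hc' j hj hne, zero_mul]]
  obtain ⟨hne, hne'⟩ := hσ (ne_of_mem_of_not_mem hj₀ hs).symm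
  rcases hc₀ with h | h
  · exact hne (funext fun i => coe_units_injective (by simp [hval, h]))
  · exact hne' (funext fun i => coe_units_injective (by simp [hval, h]))

/-- The set of sign patterns `(σₛ(i))ₛ` occurring in a tuple as `i` ranges over the sites. -/
def sitePatterns [DecidableEq ι] (σ : ι → Spin n) : Finset (ι → ℤˣ) :=
  Finset.univ.image fun i s => σ s i

variable [DecidableEq ι]

lemma exists_subtuple_card_sitePatterns_lt {σ : ι → Spin n} (hσ : PairwiseNonparallel σ)
    (hdep : ¬ LinearIndependent ℝ (signMatrix σ).row) :
    ∃ J : Finset ι, LinearIndependent ℝ (signMatrix fun j : J => σ j).row ∧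
      (sitePatterns σ).card < 2 ^ J.card := by
  obtain ⟨J, hJ, hspan⟩ := exists_linearIndependent_subtuple σ
  have hJuniv : J ≠ Finset.univ := by
    rintro rfl
    exact hdep (hJ.comp (fun s => ⟨s, Finset.mem_univ s⟩) fun s t h => congrArg Subtype.val h)
  obtain ⟨p, hp⟩ := exists_missing_pattern hσ hJuniv hspan
  refine ⟨J, hJ, ?_⟩
  have hinj : Set.InjOn J.restrict (sitePatterns σ : Set (ι → ℤˣ)) := by
    intro y hy z hz hyz
    simp only [sitePatterns, Finset.coe_image, Finset.coe_univ, Set.image_univ,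
      Set.mem_range] at hy hz
    obtain ⟨i, rfl⟩ := hy
    obtain ⟨k, rfl⟩ := hz
    funext s
    obtain ⟨c, hc⟩ := hspan s
    refine coe_units_injective ?_
    simp only [← hc]
    exact Finset.sum_congr rfl fun j hj => by rw [show σ j i = σ j k from congrFun hyz ⟨j, hj⟩]
  have hmiss : J.restrict p ∉ (sitePatterns σ).image J.restrict := by
    simp only [sitePatterns, Finset.mem_image, Finset.mem_univ, true_and, exists_exists_eq_and,
      not_exists]
    intro i hi
    obtain ⟨j, hj, hne⟩ := hp i
    exact hne (congrFun hi ⟨j, hj⟩)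
  rw [← Finset.card_image_of_injOn hinj]
  calc ((sitePatterns σ).image J.restrict).card
      < (Finset.univ : Finset (J → ℤˣ)).card :=
        Finset.card_lt_card (Finset.ssubset_univ_iff.mpr fun h => hmiss (h ▸ Finset.mem_univ _))
    _ = 2 ^ J.card := by simp

lemma card_filter_sitePatterns_eq (A : Finset (ι → ℤˣ)) :
    (Finset.univ.filter fun σ : ι → Spin n => sitePatterns σ ⊆ A).card = A.card ^ n := by
  have h : (Finset.univ.filter fun σ : ι → Spin n => sitePatterns σ ⊆ A)
      = (Fintype.piFinset fun _ : Fin n => A).map (Equiv.piComm _).toEmbedding := by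
    ext σ
    simp [Finset.mem_map_equiv, sitePatterns, Finset.image_subset_iff, Equiv.piComm]
  rw [h, Finset.card_map, Fintype.card_piFinset_const]

lemma card_filter_card_sitePatterns_lt_le (m : ℕ) :
    (Finset.univ.filter fun σ : ι → Spin n => (sitePatterns σ).card < m).card
      ≤ 2 ^ 2 ^ Fintype.card ι * (m - 1) ^ n := by
  calc (Finset.univ.filter fun σ : ι → Spin n => (sitePatterns σ).card < m).card
      ≤ ((Finset.univ.filter fun A : Finset (ι → ℤˣ) => A.card < m).biUnion fun A =>
          Finset.univ.filter fun σ : ι → Spin n => sitePatterns σ ⊆ A).card := by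
        refine Finset.card_le_card fun σ hσ => ?_
        simp only [Finset.mem_filter_univ, Finset.mem_biUnion] at hσ ⊢
        exact ⟨sitePatterns σ, hσ, subset_rfl⟩
    _ ≤ ∑ A ∈ Finset.univ.filter fun A : Finset (ι → ℤˣ) => A.card < m, (m - 1) ^ n := by
        refine Finset.card_biUnion_le.trans (Finset.sum_le_sum fun A hA => ?_)
        rw [card_filter_sitePatterns_eq]
        exact Nat.pow_le_pow_left (Nat.le_sub_one_of_lt (Finset.mem_filter_univ A |>.mp hA)) n
    _ ≤ 2 ^ 2 ^ Fintype.card ι * (m - 1) ^ n := by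
        rw [Finset.sum_const, smul_eq_mul]
        refine Nat.mul_le_mul_right _ ((Finset.card_filter_le _ _).trans (le_of_eq ?_))
        simp

omit [DecidableEq ι] in
lemma sum_windowProb_dependent_le (hn : 0 < n) {α : ℝ} {c d : ι → ℝ} (hcd : ∀ s, c s ≤ d s)
    {D : Finset (ι → Spin n)} (hD : ∀ σ ∈ D, PairwiseNonparallel σ)
    (hD' : ∀ σ ∈ D, ¬ LinearIndependent ℝ (signMatrix σ).row) :
    ∑ σ ∈ D, windowProb σ α c d ≤ ∑ J : Finset ι, 2 ^ 2 ^ Fintype.card ι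
      * (∏ s ∈ J, (d s - c s))
      * ((1 - 1 / 2 ^ J.card) ^ n * (√n ^ J.card * Real.exp (J.card * α ^ 2 / 2))) := by
  classical
  let B : Finset ι → ℝ := fun J => (∏ s ∈ J, (d s - c s)) / 2 ^ (n * J.card)
      * (√n ^ J.card * Real.exp (J.card * α ^ 2 / 2))
  have hB : ∀ J, 0 ≤ B J := fun J => mul_nonneg (div_nonneg
    (Finset.prod_nonneg fun s _ => sub_nonneg.mpr (hcd s)) (by positivity)) (by positivity)
  have hσ : ∀ σ ∈ D, windowProb σ α c d
      ≤ ∑ J, if (sitePatterns σ).card < 2 ^ J.card then B J else 0 := by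
    intro σ hσ
    obtain ⟨J, hJ, hlt⟩ := exists_subtuple_card_sitePatterns_lt (hD σ hσ) (hD' σ hσ)
    refine (windowProb_le_of_subtuple hn hJ hcd).trans ?_
    refine le_trans (le_of_eq (if_pos hlt).symm) (Finset.single_le_sum
      (f := fun J : Finset ι => if (sitePatterns σ).card < 2 ^ J.card then B J else 0)
      (fun J _ => ?_) (Finset.mem_univ J))
    split_ifs
    exacts [hB J, le_rfl]
  refine (Finset.sum_le_sum hσ).trans ?_
  rw [Finset.sum_comm]
  refine Finset.sum_le_sum fun J _ => ?_
  calc ∑ σ ∈ D, (if (sitePatterns σ).card < 2 ^ J.card then B J else 0)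
      ≤ ∑ σ : ι → Spin n, if (sitePatterns σ).card < 2 ^ J.card then B J else 0 :=
        Finset.sum_le_univ_sum_of_nonneg fun σ => by split_ifs; exacts [hB J, le_rfl]
    _ = (Finset.univ.filter fun σ : ι → Spin n => (sitePatterns σ).card < 2 ^ J.card).card
          * B J := by rw [← Finset.sum_filter, Finset.sum_const, nsmul_eq_mul]
    _ ≤ (2 ^ 2 ^ Fintype.card ι * (2 ^ J.card - 1) ^ n) * B J := by
        refine mul_le_mul_of_nonneg_right ?_ (hB J)
        have := card_filter_card_sitePatterns_lt_le (ι := ι) (n := n) (2 ^ J.card)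
        rw [← Nat.cast_le (α := ℝ)] at this
        simpa [Nat.cast_sub Nat.one_le_two_pow] using this
    _ = _ := by
        simp only [B, one_sub_div (pow_ne_zero _ two_ne_zero : (2 : ℝ) ^ J.card ≠ 0), div_pow,
          mul_comm n, pow_mul]
        ring

end DependentTuples

section Counting

variable {n : ℕ}

lemma energy_eq_abs_signedEnergy (x : Fin n → ℝ) (σ : Spin n) :
    energy x σ = |signedEnergy x σ| := by
  rw [energy, signedEnergy, abs_div, abs_of_nonneg (Real.sqrt_nonneg _)]

lemma signedEnergy_neg (x : Fin n → ℝ) (σ : Spin n) :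
    signedEnergy x (-σ) = -signedEnergy x σ := by
  simp [signedEnergy, neg_div]

lemma injOn_mk_signedEnergy_mem_Icc {x : Fin n → ℝ} (hx : ∀ σ : Spin n, signedEnergy x σ ≠ 0)
    {a : ℝ} (ha : 0 ≤ a) (b : ℝ) :
    Set.InjOn (Quotient.mk (flipSetoid n)) {σ | signedEnergy x σ ∈ Set.Icc a b} := by
  intro σ hσ τ hτ hστ
  rw [Set.mem_ofPred_eq] at hσ hτ
  rcases Quotient.exact hστ with rfl | rfl
  · rfl
  · rw [signedEnergy_neg] at hτ
    exact absurd (le_antisymm (by linarith [hτ.1]) (ha.trans hσ.1)) (hx σ)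

lemma image_mk_signedEnergy_mem_Icc (x : Fin n → ℝ) {a : ℝ} (ha : 0 ≤ a) (b : ℝ) :
    Quotient.mk (flipSetoid n) '' {σ | signedEnergy x σ ∈ Set.Icc a b}
      = {p | Partition.energy x p ∈ Set.Icc a b} := by
  ext p
  constructor
  · rintro ⟨σ, hσ, rfl⟩
    rw [Set.mem_ofPred_eq] at hσ
    change energy x σ ∈ Set.Icc a b
    rwa [energy_eq_abs_signedEnergy, abs_of_nonneg (ha.trans hσ.1)]
  · induction p using Quotient.inductionOn with | h σ => ?_
    intro hσ
    change energy x σ ∈ Set.Icc a b at hσ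
    rw [energy_eq_abs_signedEnergy] at hσ
    rcases abs_choice (signedEnergy x σ) with h | h <;> rw [h] at hσ
    · exact ⟨σ, hσ, rfl⟩
    · rw [← signedEnergy_neg] at hσ
      exact ⟨-σ, hσ, Quotient.sound (Or.inr (neg_neg σ).symm)⟩

lemma numPoints_eq_card {x : Fin n → ℝ} (hx : ∀ σ : Spin n, signedEnergy x σ ≠ 0) {a : ℝ}
    (ha : 0 ≤ a) (b : ℝ) :
    numPoints x a b = Fintype.card {σ : Spin n // signedEnergy x σ ∈ Set.Icc a b} := by
  rw [numPoints, ← image_mk_signedEnergy_mem_Icc x ha,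
    (injOn_mk_signedEnergy_mem_Icc hx ha b).ncard_image, ← Nat.card_coe_set_eq,
    Nat.card_eq_fintype_card]
  rfl

variable {L : Type*} [Fintype L]

/-- The tuples, indexed by the disjoint union of blocks of sizes `k l`, whose entries within each
block are distinct. -/
def blockInjective (S : Type*) [Fintype S] [DecidableEq S] [DecidableEq L] (k : L → ℕ) :
    Finset ((Σ l, Fin (k l)) → S) :=
  {σ | ∀ l, Function.Injective fun j => σ ⟨l, j⟩}

variable [DecidableEq L]

lemma prod_descFactorial_card {S : Type*} [Fintype S] [DecidableEq S] (k : L → ℕ)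
    (p : L → S → Prop) [∀ l, DecidablePred (p l)] :
    ∏ l, (Fintype.card {σ // p l σ}).descFactorial (k l)
      = ((blockInjective S k).filter fun σ => ∀ s, p s.1 (σ s)).card := by
  have hemb : ∀ l, (Fintype.card {σ // p l σ}).descFactorial (k l)
      = Fintype.card (Fin (k l) ↪ {σ // p l σ}) := fun l => by
    rw [Fintype.card_embedding_eq, Fintype.card_fin]
  simp_rw [hemb]
  rw [blockInjective, Finset.filter_filter, ← Fintype.card_pi, ← Fintype.card_subtype]
  exact Fintype.card_congr
    { toFun := fun f => ⟨fun s => (f s.1 s.2).1,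
        fun l i j h => (f l).injective (Subtype.ext h), fun s => (f s.1 s.2).2⟩
      invFun := fun σ l => ⟨fun j => ⟨σ.1 ⟨l, j⟩, σ.2.2 ⟨l, j⟩⟩,
        fun i j h => σ.2.1 l (congrArg Subtype.val h)⟩
      left_inv := fun _ => rfl
      right_inv := fun _ => rfl }

lemma measurableSet_energyWindow {ι : Type*} [Countable ι] (σ : ι → Spin n) (α : ℝ)
    (c d : ι → ℝ) : MeasurableSet (energyWindow σ α c d) := by
  simp only [energyWindow, Set.ofPred_forall]
  refine MeasurableSet.iInter fun s => ?_
  have : Measurable fun x => signedEnergy x (σ s) := by unfold signedEnergy; fun_prop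
  exact this measurableSet_Icc

lemma prod_descFactorial_numPoints {x : Fin n → ℝ} (hx : ∀ σ : Spin n, signedEnergy x σ ≠ 0)
    {α : ℝ} (hα : 0 ≤ α) {c : L → ℝ} (hc : ∀ l, 0 ≤ c l) (d : L → ℝ) (k : L → ℕ) :
    ∏ l, ((numPoints x (α + c l * scaling n α) (α + d l * scaling n α)).descFactorial (k l) : ℝ)
      = ∑ σ ∈ blockInjective (Spin n) k,
          (energyWindow σ α (fun s => c s.1) fun s => d s.1).indicator 1 x := by
  classical
  have hlow : ∀ l, 0 ≤ α + c l * scaling n α := fun l =>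
    add_nonneg hα (mul_nonneg (hc l) (scaling_pos n α).le)
  simp_rw [numPoints_eq_card hx (hlow _), ← Nat.cast_prod, prod_descFactorial_card k fun l σ =>
    signedEnergy x σ ∈ Set.Icc (α + c l * scaling n α) (α + d l * scaling n α),
    Finset.card_filter, Nat.cast_sum, Nat.cast_ite, Nat.cast_one, Nat.cast_zero,
    Set.indicator_apply, energyWindow, Set.mem_ofPred_eq, Pi.one_apply]
  exact Finset.sum_congr rfl fun σ _ => by congr

lemma linearIndependent_signMatrix_of_unique {ι : Type*} [Unique ι] (hn : 0 < n)
    (σ : ι → Spin n) : LinearIndependent ℝ (signMatrix σ).row := by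
  refine linearIndependent_unique_iff.mpr fun h => ?_
  have := congrFun h ⟨0, hn⟩
  simp [signMatrix, Matrix.row] at this

lemma ae_signedEnergy_ne (hn : 0 < n) (σ : Spin n) (a : ℝ) :
    ∀ᵐ x ∂stdGaussianPi (Fin n), signedEnergy x σ ≠ a := by
  have h := windowProb_le_of_linearIndependent hn
    (linearIndependent_signMatrix_of_unique hn fun _ : Unit => σ) (α := a) (c := 0) (d := 0)
    fun _ => le_rfl
  simp only [Pi.zero_apply, sub_self, Finset.univ_unique, Finset.prod_const,
    Finset.card_singleton, pow_one, zero_div, zero_mul] at h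
  have hzero := le_antisymm h (windowProb_nonneg _ _ _ _)
  simpa [windowProb, energyWindow, measureReal_eq_zero_iff, ae_iff] using hzero

lemma map_eq_stdGaussianPi {Ω : Type*} [MeasurableSpace Ω] {P : Measure Ω} {X : Fin n → Ω → ℝ}
    (hind : iIndepFun X P) (hlaw : ∀ i, HasLaw (X i) (gaussianReal 0 1) P) :
    P.map (fun ω i => X i ω) = stdGaussianPi (Fin n) := by
  have hprob : IsProbabilityMeasure P := hind.isProbabilityMeasure
  rw [(iIndepFun_iff_map_fun_eq_pi_map fun i => (hlaw i).aemeasurable).mp hind]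
  congr 1
  ext1 i
  exact (hlaw i).map_eq

/-- The mixed factorial moment `𝔼[∏ₗ (Z_n(aₗ, bₗ))_{kₗ}]` for the windows
`[aₗ, bₗ] = [α + cₗ ξ_n, α + dₗ ξ_n]`. -/
noncomputable def factorialMoment {Ω : Type*} [MeasurableSpace Ω] (P : Measure Ω)
    (X : Fin n → Ω → ℝ) (α : ℝ) (c d : L → ℝ) (k : L → ℕ) : ℝ :=
  ∫ ω, ∏ l, ((numPoints (fun i => X i ω) (α + c l * scaling n α)
    (α + d l * scaling n α)).descFactorial (k l) : ℝ) ∂P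

lemma factorialMoment_eq_sum_windowProb {Ω : Type*} [MeasurableSpace Ω] {P : Measure Ω}
    {X : Fin n → Ω → ℝ} (hn : 0 < n) (hind : iIndepFun X P)
    (hlaw : ∀ i, HasLaw (X i) (gaussianReal 0 1) P) {α : ℝ} (hα : 0 ≤ α) {c : L → ℝ}
    (hc : ∀ l, 0 ≤ c l) (d : L → ℝ) (k : L → ℕ) :
    factorialMoment P X α c d k
      = ∑ σ ∈ blockInjective (Spin n) k, windowProb σ α (fun s => c s.1) fun s => d s.1 := by
  have hX : AEMeasurable (fun ω i => X i ω) P :=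
    aemeasurable_pi_lambda _ fun i => (hlaw i).aemeasurable
  have hae : ∀ᵐ x ∂stdGaussianPi (Fin n), ∀ σ : Spin n, signedEnergy x σ ≠ 0 :=
    ae_all_iff.mpr fun σ => ae_signedEnergy_ne hn σ 0
  rw [← map_eq_stdGaussianPi hind hlaw] at hae
  have hwindow : ∀ σ : (Σ l, Fin (k l)) → Spin n,
      MeasurableSet (energyWindow σ α (fun s => c s.1) fun s => d s.1) := fun σ =>
    measurableSet_energyWindow σ α _ _
  calc factorialMoment P X α c d k
      = ∫ ω, ∑ σ ∈ blockInjective (Spin n) k,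
          (energyWindow σ α (fun s => c s.1) fun s => d s.1).indicator
            (1 : (Fin n → ℝ) → ℝ) (fun i => X i ω) ∂P :=
        integral_congr_ae <| (ae_of_ae_map hX hae).mono fun ω hω =>
          prod_descFactorial_numPoints hω hα hc d k
    _ = ∫ x, ∑ σ ∈ blockInjective (Spin n) k,
          (energyWindow σ α (fun s => c s.1) fun s => d s.1).indicator
            (1 : (Fin n → ℝ) → ℝ) x ∂stdGaussianPi (Fin n) := by
        rw [← map_eq_stdGaussianPi hind hlaw]
        exact (integral_map hX (Finset.measurable_fun_sum _ fun σ _ =>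
          measurable_one.indicator (hwindow σ)).aestronglyMeasurable).symm
    _ = _ := by
        refine (integral_finsetSum _ fun σ _ => ?_).trans
          (Finset.sum_congr rfl fun σ _ => integral_indicator_one (hwindow σ))
        exact (integrable_const (1 : ℝ)).indicator (hwindow σ)

lemma windowProb_eq_zero_of_forall {ι : Type*} (hn : 0 < n) {σ : ι → Spin n} {α : ℝ}
    {c d : ι → ℝ} (s : ι) (a : ℝ)
    (h : ∀ x ∈ energyWindow σ α c d, signedEnergy x (σ s) = a) : windowProb σ α c d = 0 := by
  rw [windowProb, measureReal_eq_zero_iff]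
  have hae := ae_signedEnergy_ne hn (σ s) a
  simp only [ne_eq, ae_iff, not_not] at hae
  exact measure_mono_null h hae

lemma eq_max_of_disjoint_Ioo {a b a' b' y : ℝ} (h : Disjoint (Set.Ioo a b) (Set.Ioo a' b'))
    (hy : y ∈ Set.Icc a b) (hy' : y ∈ Set.Icc a' b') : y = max a a' := by
  refine le_antisymm ?_ (max_le hy.1 hy'.1)
  rw [Set.disjoint_iff_inter_eq_empty, Set.Ioo_inter_Ioo, Set.Ioo_eq_empty_iff, not_lt] at h
  exact (le_min hy.2 hy'.2).trans h

lemma windowProb_eq_zero_of_not_pairwiseNonparallel (hn : 0 < n) {α : ℝ} (hα : 0 ≤ α)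
    {c d : L → ℝ} (hc : ∀ l, 0 ≤ c l)
    (hdisj : Pairwise fun l l' => Disjoint (Set.Ioo (c l) (d l)) (Set.Ioo (c l') (d l')))
    {k : L → ℕ} {σ : (Σ l, Fin (k l)) → Spin n} (hσ : σ ∈ blockInjective (Spin n) k)
    (hpar : ¬ PairwiseNonparallel σ) :
    windowProb σ α (fun s => c s.1) (fun s => d s.1) = 0 := by
  have hξ := scaling_pos n α
  simp only [PairwiseNonparallel, Pairwise, not_forall, not_and_or, not_not] at hpar
  obtain ⟨s, t, hst, h | h⟩ := hpar
  · have hl : s.1 ≠ t.1 := by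
      rintro hl
      obtain ⟨l, i⟩ := s
      obtain ⟨l', j⟩ := t
      obtain rfl : l = l' := hl
      exact hst (by rw [(Finset.mem_filter.mp hσ).2 l h])
    refine windowProb_eq_zero_of_forall hn s
      (max (α + c s.1 * scaling n α) (α + c t.1 * scaling n α)) fun x hx =>
        eq_max_of_disjoint_Ioo ?_ (hx s) (h ▸ hx t)
    have himage : ∀ l, Set.Ioo (α + c l * scaling n α) (α + d l * scaling n α)
        = (fun y => (y - α) / scaling n α) ⁻¹' Set.Ioo (c l) (d l) := fun l => by
      ext y
      simp [lt_div_iff₀ hξ, div_lt_iff₀ hξ, lt_sub_iff_add_lt', sub_lt_iff_lt_add']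
    rw [himage, himage]
    exact (hdisj hl).preimage _
  · refine windowProb_eq_zero_of_forall hn s 0 fun x hx => ?_
    have hs := hα.trans (le_add_of_nonneg_right (mul_nonneg (hc s.1) hξ.le)) |>.trans (hx s).1
    have ht := hα.trans (le_add_of_nonneg_right (mul_nonneg (hc t.1) hξ.le)) |>.trans (hx t).1
    rw [h, signedEnergy_neg] at hs ⊢
    linarith

end Counting

section TupleSums

open scoped BigOperators

variable {ι : Type*} [Fintype ι] [DecidableEq ι] {n : ℕ}

lemma expect_tuples_eq (f : (ι → Spin n) → ℝ) :
    𝔼 σ, f σ = (∑ σ, f σ) / 2 ^ (n * Fintype.card ι) := by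
  rw [Fintype.expect_eq_sum_div_card]
  simp [Spin, pow_mul]

lemma sum_le_mul_expect {D : Finset (ι → Spin n)} {γ : ℝ} (hγ : 0 ≤ γ)
    {a f : (ι → Spin n) → ℝ} (hf : ∀ σ, 0 ≤ f σ)
    (h : ∀ σ ∈ D, a σ ≤ γ / 2 ^ (n * Fintype.card ι) * f σ) : ∑ σ ∈ D, a σ ≤ γ * 𝔼 σ, f σ := by
  calc ∑ σ ∈ D, a σ ≤ γ / 2 ^ (n * Fintype.card ι) * ∑ σ ∈ D, f σ := by
        rw [Finset.mul_sum]
        exact Finset.sum_le_sum h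
    _ ≤ γ / 2 ^ (n * Fintype.card ι) * ∑ σ, f σ := by
        gcongr
        exacts [fun σ _ _ => hf σ, D.subset_univ]
    _ = γ * 𝔼 σ, f σ := by rw [expect_tuples_eq, div_mul_eq_mul_div, mul_div_assoc]

variable {α K : ℝ} {c d : ι → ℝ}

lemma sum_windowProb_le_pairMGF_pow (hn : 0 < n) (hα : 0 ≤ α) (hc : ∀ s, 0 ≤ c s)
    (hcd : ∀ s, c s ≤ d s) (hK : ∀ s, d s ≤ K) {δ : ℝ} (hδ : 0 ≤ δ) {D : Finset (ι → Spin n)}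
    (hD : ∀ σ ∈ D, LinearIndependent ℝ (signMatrix σ).row)
    (hdet : ∀ σ ∈ D, (√(overlap σ).det)⁻¹ ≤ 1 + δ) :
    ∑ σ ∈ D, windowProb σ α c d ≤ (∏ s, (d s - c s)) * ((1 + δ)
      * (Real.exp (3 / 2 * Fintype.card ι ^ 2 * windowError n α K)
        * pairMGF ι (α ^ 2 / n) ^ n)) := by
  have hγ : 0 ≤ ∏ s, (d s - c s) := Finset.prod_nonneg fun s _ => sub_nonneg.mpr (hcd s)
  rw [← expect_exp_sum_pairSum, Finset.mul_expect, Finset.mul_expect]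
  refine sum_le_mul_expect hγ (fun σ => by positivity) fun σ hσ => ?_
  refine (windowProb_le_exp_pairSum hn (posDef_overlap_of_linearIndependent hn (hD σ hσ)) hα hc
    hcd hK).trans ?_
  rw [add_comm, Real.exp_add]
  gcongr
  exact hdet σ hσ

lemma sum_windowProb_le_of_not_isNearOrthogonal (hn : 0 < n) (hcd : ∀ s, c s ≤ d s) {ε : ℝ}
    (hε : 0 ≤ ε) {D : Finset (ι → Spin n)}
    (hD : ∀ σ ∈ D, LinearIndependent ℝ (signMatrix σ).row)
    (hfar : ∀ σ ∈ D, ¬ IsNearOrthogonal ε σ) :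
    ∑ σ ∈ D, windowProb σ α c d ≤ (∏ s, (d s - c s)) * (2 * Fintype.card ι ^ 2
      * (√n ^ Fintype.card ι * Real.exp (Fintype.card ι * α ^ 2 / 2)
        * Real.exp (-(n * ε ^ 2 / 2)))) := by
  have hγ : 0 ≤ ∏ s, (d s - c s) := Finset.prod_nonneg fun s _ => sub_nonneg.mpr (hcd s)
  set B := √n ^ Fintype.card ι * Real.exp (Fintype.card ι * α ^ 2 / 2)
  calc ∑ σ ∈ D, windowProb σ α c d
      ≤ (∏ s, (d s - c s)) * 𝔼 σ, B * Set.indicator {σ | ¬ IsNearOrthogonal ε σ} 1 σ := by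
        refine sum_le_mul_expect hγ (fun σ => ?_) fun σ hσ => ?_
        · exact mul_nonneg (by positivity) (Set.indicator_nonneg (fun _ _ => zero_le_one) σ)
        · rw [Set.indicator_of_mem (by exact hfar σ hσ), Pi.one_apply, mul_one]
          exact windowProb_le_of_linearIndependent hn (hD σ hσ) hcd
    _ ≤ (∏ s, (d s - c s))
          * (B * (Fintype.card ι ^ 2 * (2 * Real.exp (-(n * ε ^ 2 / 2))))) := by
        rw [← Finset.mul_expect]
        gcongr
        exact expect_indicator_not_isNearOrthogonal_le hn hε
    _ = _ := by ring

/-- The contribution to a factorial moment of the tuples that are not near-orthogonal: the first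
summand bounds that of the linearly independent ones, the second that of the linearly dependent
ones. -/
noncomputable def tupleRemainder (n : ℕ) (α ε : ℝ) (c d : ι → ℝ) : ℝ :=
  (∏ s, (d s - c s)) * (2 * Fintype.card ι ^ 2 * (√n ^ Fintype.card ι
      * Real.exp (Fintype.card ι * α ^ 2 / 2) * Real.exp (-(n * ε ^ 2 / 2))))
    + ∑ J : Finset ι, 2 ^ 2 ^ Fintype.card ι * (∏ s ∈ J, (d s - c s))
      * ((1 - 1 / 2 ^ J.card) ^ n * (√n ^ J.card * Real.exp (J.card * α ^ 2 / 2)))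

omit [DecidableEq ι] in
lemma tupleRemainder_nonneg {ε : ℝ} (hcd : ∀ s, c s ≤ d s) :
    0 ≤ tupleRemainder n α ε c d := by
  have hγ (J : Finset ι) : 0 ≤ ∏ s ∈ J, (d s - c s) :=
    Finset.prod_nonneg fun s _ => sub_nonneg.mpr (hcd s)
  have hbase (J : Finset ι) : 0 ≤ 1 - 1 / (2 : ℝ) ^ J.card :=
    sub_nonneg.mpr (div_le_one_of_le₀ (one_le_pow₀ one_le_two) (by positivity))
  exact add_nonneg (mul_nonneg (hγ Finset.univ) (by positivity)) <| Finset.sum_nonneg fun J _ =>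
    mul_nonneg (mul_nonneg (by positivity) (hγ J)) (mul_nonneg (pow_nonneg (hbase J) n)
      (by positivity))

lemma sum_windowProb_le (hn : 0 < n) (hα : 0 ≤ α) (hc : ∀ s, 0 ≤ c s) (hcd : ∀ s, c s ≤ d s)
    (hK : ∀ s, d s ≤ K) {δ ε : ℝ} (hδ : 0 ≤ δ) (hε : 0 ≤ ε)
    (hdet : ∀ σ : ι → Spin n, IsNearOrthogonal ε σ → (√(overlap σ).det)⁻¹ ≤ 1 + δ)
    {G : Finset (ι → Spin n)}
    (hG : ∀ σ ∈ G, ¬ PairwiseNonparallel σ → windowProb σ α c d = 0) :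
    ∑ σ ∈ G, windowProb σ α c d ≤ (∏ s, (d s - c s)) * ((1 + δ)
      * (Real.exp (3 / 2 * Fintype.card ι ^ 2 * windowError n α K)
        * pairMGF ι (α ^ 2 / n) ^ n)) + tupleRemainder n α ε c d := by
  classical
  set I := G.filter fun σ => LinearIndependent ℝ (signMatrix σ).row
  set D := G.filter fun σ => ¬ LinearIndependent ℝ (signMatrix σ).row
  have hI : ∀ σ ∈ I, LinearIndependent ℝ (signMatrix σ).row := fun σ hσ =>
    (Finset.mem_filter.mp hσ).2
  have hdependent : ∑ σ ∈ D, windowProb σ α c d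
      = ∑ σ ∈ D with PairwiseNonparallel σ, windowProb σ α c d := by
    refine (Finset.sum_filter_of_ne fun σ hσ hne => ?_).symm
    exact not_not.mp fun h => hne (hG σ (Finset.mem_filter.mp hσ).1 h)
  rw [← Finset.sum_filter_add_sum_filter_not G fun σ => LinearIndependent ℝ (signMatrix σ).row,
    ← Finset.sum_filter_add_sum_filter_not I (IsNearOrthogonal ε), hdependent, add_assoc]
  refine add_le_add (sum_windowProb_le_pairMGF_pow hn hα hc hcd hK hδ
    (fun σ hσ => hI σ (Finset.mem_filter.mp hσ).1) fun σ hσ => hdet σ (Finset.mem_filter.mp hσ).2)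
    (add_le_add (sum_windowProb_le_of_not_isNearOrthogonal hn hcd hε
      (fun σ hσ => hI σ (Finset.mem_filter.mp hσ).1) fun σ hσ => (Finset.mem_filter.mp hσ).2)
      (sum_windowProb_dependent_le hn hcd (fun σ hσ => (Finset.mem_filter.mp hσ).2) fun σ hσ =>
        (Finset.mem_filter.mp (Finset.mem_filter.mp hσ).1).2))

/-- An upper bound, as a function of `k = card ι`, for the mean of `overlapDefect` under the tuple
weights tilted by `exp (α² / n * ∑ᵢ pairSum)`. -/
noncomputable def tiltedDefectBound (n : ℕ) (α k : ℝ) : ℝ :=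
  k ^ 2 * (1 / n + 4 * (α ^ 2 / n) ^ 2 * k ^ 4)

lemma exp_neg_mul_tiltedDefectBound (hn : 0 < n) (α k : ℝ) :
    Real.exp (-(k * α ^ 2 * tiltedDefectBound n α k))
      = Real.exp (-(k ^ 3 * (α ^ 2 / n))) * Real.exp (-(4 * k ^ 7 * (α ^ 6 / (n : ℝ) ^ 2))) := by
  rw [tiltedDefectBound, ← Real.exp_add]
  congr 1
  field

lemma le_sum_windowProb (hn : 0 < n) (hα : 0 ≤ α) (hK₀ : 0 ≤ K) (hc : ∀ s, 0 ≤ c s)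
    (hcd : ∀ s, c s ≤ d s) (hK : ∀ s, d s ≤ K) {δ ε : ℝ} (hδ : δ ≤ 1) (hε₀ : 0 < ε)
    (hε : Fintype.card ι * ε ≤ 1 / 2)
    (hdet : ∀ σ : ι → Spin n, IsNearOrthogonal ε σ → 1 - δ ≤ (√(overlap σ).det)⁻¹)
    (hβ : α ^ 2 / n * (Fintype.card ι : ℝ) ^ 2 ≤ 1)
    (hdefect : tiltedDefectBound n α (Fintype.card ι) ≤ ε ^ 2) {G : Finset (ι → Spin n)}
    (hG : ∀ σ, IsNearOrthogonal ε σ → σ ∈ G) :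
    (∏ s, (d s - c s)) * ((1 - δ)
        * Real.exp (-((3 / 2 * Fintype.card ι ^ 2 + Fintype.card ι ^ 3) * windowError n α K))
        * (pairMGF ι (α ^ 2 / n) ^ n
          * ((1 - tiltedDefectBound n α (Fintype.card ι) / ε ^ 2)
            * Real.exp (-(Fintype.card ι * α ^ 2 * tiltedDefectBound n α (Fintype.card ι))))))
      ≤ ∑ σ ∈ G, windowProb σ α c d := by
  classical
  have hγ : 0 ≤ ∏ s, (d s - c s) := Finset.prod_nonneg fun s _ => sub_nonneg.mpr (hcd s)
  set r := Real.exp (-((3 / 2 * Fintype.card ι ^ 2 + Fintype.card ι ^ 3) * windowError n α K))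
  set f : (ι → Spin n) → ℝ := fun σ => Real.exp (α ^ 2 / n * (∑ i, pairSum fun s => σ s i)
    - Fintype.card ι * α ^ 2 * overlapDefect σ)
  have hterm (σ : ι → Spin n) (hσ : IsNearOrthogonal ε σ) :
      (∏ s, (d s - c s)) / 2 ^ (n * Fintype.card ι) * ((1 - δ) * r * f σ)
        ≤ windowProb σ α c d := by
    refine le_trans ?_ (exp_pairSum_sub_overlapDefect_le_windowProb hn hσ hε hα hK₀ hc hcd hK)
    rw [sub_eq_add_neg _ (_ * windowError n α K), Real.exp_add, mul_assoc, mul_comm r]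
    gcongr
    exact hdet σ hσ
  calc (∏ s, (d s - c s)) * ((1 - δ) * r * (pairMGF ι (α ^ 2 / n) ^ n
          * ((1 - tiltedDefectBound n α (Fintype.card ι) / ε ^ 2)
            * Real.exp (-(Fintype.card ι * α ^ 2 * tiltedDefectBound n α (Fintype.card ι))))))
      ≤ (∏ s, (d s - c s)) * ((1 - δ) * r
          * 𝔼 σ, Set.indicator {σ | IsNearOrthogonal ε σ} f σ) := by
        gcongr
        exact le_expect_indicator_isNearOrthogonal hn (by positivity) hβ (by positivity) hε₀
          hdefect le_rfl
    _ = ∑ σ with IsNearOrthogonal ε σ,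
          (∏ s, (d s - c s)) / 2 ^ (n * Fintype.card ι) * ((1 - δ) * r * f σ) := by
        rw [expect_tuples_eq, ← Finset.mul_sum, ← Finset.mul_sum, Finset.sum_filter]
        simp only [Set.indicator_apply, Set.mem_ofPred_eq]
        ring
    _ ≤ ∑ σ with IsNearOrthogonal ε σ, windowProb σ α c d :=
        Finset.sum_le_sum fun σ hσ => hterm σ (Finset.mem_filter.mp hσ).2
    _ ≤ ∑ σ ∈ G, windowProb σ α c d :=
        Finset.sum_le_sum_of_subset_of_nonneg (fun σ hσ => hG σ (Finset.mem_filter.mp hσ).2)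
          fun σ _ _ => windowProb_nonneg σ α c d

end TupleSums

section Limits

variable {α : ℕ → ℝ}

lemma tendsto_sq_div_nat (hα : α =o[atTop] fun n : ℕ => √(n : ℝ)) :
    Tendsto (fun n : ℕ => α n ^ 2 / n) atTop (𝓝 0) := by
  refine Tendsto.congr (fun n => ?_) (by simpa only [ne_eq, OfNat.ofNat_ne_zero,
    not_false_eq_true, zero_pow] using hα.tendsto_div_nhds_zero.pow 2)
  rw [div_pow, Real.sq_sqrt (Nat.cast_nonneg n)]

lemma tendsto_sqrt_pow_mul_exp (hα : α =o[atTop] fun n : ℕ => √(n : ℝ)) (r : ℕ) {a : ℝ}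
    (ha : 0 < a) :
    Tendsto (fun n : ℕ => √(n : ℝ) ^ r * Real.exp (r * α n ^ 2 / 2) * Real.exp (-(n * a)))
      atTop (𝓝 0) := by
  have hlim : Tendsto (fun n : ℕ => (n : ℝ) ^ r * Real.exp (-(a / 2)) ^ n) atTop (𝓝 0) :=
    tendsto_pow_const_mul_const_pow_of_lt_one r (Real.exp_pos _).le
      (Real.exp_lt_one_iff.mpr (neg_lt_zero.mpr (half_pos ha)))
  have hsmall : ∀ᶠ n : ℕ in atTop, r * (α n ^ 2 / n) < a := by
    have := (tendsto_sq_div_nat hα).const_mul (r : ℝ)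
    rw [mul_zero] at this
    exact this.eventually_lt_const ha
  refine squeeze_zero' (Eventually.of_forall fun n => by positivity) ?_ hlim
  filter_upwards [hsmall, eventually_gt_atTop 0] with n hn hn₀
  have hexp : r * α n ^ 2 ≤ a * n := by
    rw [mul_div_assoc'] at hn
    exact ((div_lt_iff₀ (by positivity)).mp hn).le
  rw [mul_assoc, ← Real.exp_add, ← Real.exp_nat_mul]
  gcongr
  · exact Real.sqrt_le_self_iff.mpr (.inr (by exact_mod_cast hn₀))
  · linear_combination hexp / 2

lemma tendsto_sqrt_mul_scaling (hα : α =o[atTop] fun n : ℕ => √(n : ℝ)) :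
    Tendsto (fun n : ℕ => √(n : ℝ) * scaling n (α n)) atTop (𝓝 0) := by
  have hlim := (tendsto_sqrt_pow_mul_exp hα 1 (Real.log_pos one_lt_two)).const_mul
    (√(2 * Real.pi))
  rw [mul_zero] at hlim
  refine hlim.congr' ?_
  filter_upwards [eventually_gt_atTop 0] with n hn
  rw [scaling_eq hn, Real.exp_neg, Real.exp_nat_mul, Real.exp_log two_pos, Nat.cast_one, one_mul,
    pow_one]
  ring

lemma tendsto_windowError (hα : α =o[atTop] fun n : ℕ => √(n : ℝ)) (K : ℝ) :
    Tendsto (fun n => windowError n (α n) K) atTop (𝓝 0) := by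
  have hscaling : Tendsto (fun n => scaling n (α n)) atTop (𝓝 0) := by
    refine squeeze_zero' (Eventually.of_forall fun n => (scaling_pos _ _).le) ?_
      (tendsto_sqrt_mul_scaling hα)
    filter_upwards [eventually_gt_atTop 0] with n hn
    exact le_mul_of_one_le_left (scaling_pos _ _).le (Real.one_le_sqrt.mpr (by exact_mod_cast hn))
  have hmul : Tendsto (fun n => α n * scaling n (α n)) atTop (𝓝 0) :=
    (hα.isBigO.mul (isBigO_refl _ _)).trans_tendsto (tendsto_sqrt_mul_scaling hα)
  have h := (hmul.const_mul (2 * K)).add ((hscaling.const_mul K).pow 2)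
  simp only [mul_zero, ne_eq, OfNat.ofNat_ne_zero, not_false_eq_true, zero_pow, add_zero] at h
  refine h.congr fun n => ?_
  rw [windowError]
  ring

lemma tendsto_tupleRemainder {ι : Type*} [Fintype ι] (hα : α =o[atTop] fun n : ℕ => √(n : ℝ))
    {ε : ℝ} (hε : 0 < ε) (c d : ι → ℝ) :
    Tendsto (fun n => tupleRemainder n (α n) ε c d) atTop (𝓝 0) := by
  have hfar : Tendsto (fun n : ℕ => √(n : ℝ) ^ Fintype.card ι
      * Real.exp (Fintype.card ι * α n ^ 2 / 2) * Real.exp (-(n * ε ^ 2 / 2))) atTop (𝓝 0) := by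
    simpa only [mul_div_assoc] using
      tendsto_sqrt_pow_mul_exp hα (Fintype.card ι) (by positivity : 0 < ε ^ 2 / 2)
  have hdependent (J : Finset ι) : Tendsto (fun n : ℕ => (1 - 1 / (2 : ℝ) ^ J.card) ^ n
      * (√(n : ℝ) ^ J.card * Real.exp (J.card * α n ^ 2 / 2))) atTop (𝓝 0) := by
    have hbase : 0 ≤ 1 - 1 / (2 : ℝ) ^ J.card :=
      sub_nonneg.mpr (div_le_one_of_le₀ (one_le_pow₀ one_le_two) (by positivity))
    refine squeeze_zero (fun n => by positivity) (fun n => ?_)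
      (tendsto_sqrt_pow_mul_exp hα J.card (by positivity : 0 < 1 / (2 : ℝ) ^ J.card))
    rw [mul_comm, neg_mul_eq_mul_neg, Real.exp_nat_mul]
    gcongr
    exact Real.one_sub_le_exp_neg _
  simpa only [tupleRemainder, mul_zero, Finset.sum_const_zero, add_zero] using
    ((hfar.const_mul (2 * (Fintype.card ι : ℝ) ^ 2)).const_mul (∏ s, (d s - c s))).add
      (tendsto_finsetSum Finset.univ fun J _ =>
        (hdependent J).const_mul (2 ^ 2 ^ Fintype.card ι * ∏ s ∈ J, (d s - c s)))

lemma tendsto_tiltedDefectBound (hα : α =o[atTop] fun n : ℕ => √(n : ℝ)) (k : ℝ) :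
    Tendsto (fun n => tiltedDefectBound n (α n) k) atTop (𝓝 0) := by
  simpa [tiltedDefectBound] using (tendsto_one_div_atTop_nhds_zero_nat.add
    ((((tendsto_sq_div_nat hα).pow 2).const_mul 4).mul_const (k ^ 4))).const_mul (k ^ 2)

end Limits

section TupleSumAsymptotics

lemma exists_isNearOrthogonal_threshold (ι : Type*) [Fintype ι] [DecidableEq ι] {δ : ℝ}
    (hδ : 0 < δ) :
    ∃ ε : ℝ, 0 < ε ∧ Fintype.card ι * ε ≤ 1 / 2 ∧ ε < 1 ∧ ∀ {n : ℕ} (σ : ι → Spin n),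
      IsNearOrthogonal ε σ → |(√(overlap σ).det)⁻¹ - 1| ≤ δ := by
  obtain ⟨ε₀, hε₀, hdet⟩ := exists_abs_inv_sqrt_det_sub_one_le ι hδ
  set k : ℝ := (Fintype.card ι : ℝ)
  have hk₀ : 0 ≤ k := Nat.cast_nonneg _
  have hmin : min ε₀ (1 / (2 * (k + 1))) * (2 * (k + 1)) ≤ 1 :=
    (le_div_iff₀ (by positivity)).mp (min_le_right _ _)
  have hpos : 0 < min ε₀ (1 / (2 * (k + 1))) := lt_min hε₀ (by positivity)
  exact ⟨_, hpos, by linarith, by nlinarith, fun σ hσ =>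
    hdet _ fun s t => (hσ s t).trans (min_le_left _ _)⟩

variable {ι : Type*} [Fintype ι] [DecidableEq ι]
variable {α : ℕ → ℝ} {c d : ι → ℝ} {G : ∀ n, Finset (ι → Spin n)}

lemma eventually_sum_windowProb_le (hα₀ : ∀ n, 0 ≤ α n)
    (hα : α =o[atTop] fun n : ℕ => √(n : ℝ)) (hc : ∀ s, 0 ≤ c s) (hcd : ∀ s, c s < d s)
    (hG : ∀ n, 0 < n → ∀ σ ∈ G n, ¬ PairwiseNonparallel σ → windowProb σ (α n) c d = 0)
    {δ : ℝ} (hδ : 0 < δ) :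
    ∀ᶠ n : ℕ in atTop, ∑ σ ∈ G n, windowProb σ (α n) c d
      ≤ (∏ s, (d s - c s)) * (1 + δ) * pairMGF ι (α n ^ 2 / n) ^ n := by
  have hγ : 0 < ∏ s, (d s - c s) := Finset.prod_pos fun s _ => sub_pos.mpr (hcd s)
  obtain ⟨K, hK⟩ := Finite.exists_le d
  obtain ⟨ε, hε₀, -, -, hdet⟩ := exists_isNearOrthogonal_threshold ι (half_pos hδ)
  have hlim : Tendsto (fun n => (1 + δ / 2)
      * Real.exp (3 / 2 * Fintype.card ι ^ 2 * windowError n (α n) K)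
      + tupleRemainder n (α n) ε c d / ∏ s, (d s - c s)) atTop (𝓝 (1 + δ / 2)) := by
    simpa using ((((tendsto_windowError hα K).const_mul (3 / 2 * (Fintype.card ι : ℝ) ^ 2)).rexp
      ).const_mul (1 + δ / 2)).add ((tendsto_tupleRemainder hα hε₀ c d).div_const _)
  filter_upwards [eventually_gt_atTop 0,
    hlim.eventually_le_const (by linarith : 1 + δ / 2 < 1 + δ)] with n hn hfactor
  have hMGF : 1 ≤ pairMGF ι (α n ^ 2 / n) ^ n := one_le_pow₀ (one_le_pairMGF _)
  refine (sum_windowProb_le hn (hα₀ n) hc (fun s => (hcd s).le) hK (half_pos hδ).le hε₀.le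
    (fun σ hσ => by linarith [(abs_le.mp (hdet σ hσ)).2]) (hG n hn)).trans ?_
  calc _ ≤ (∏ s, (d s - c s)) * ((1 + δ / 2)
          * (Real.exp (3 / 2 * Fintype.card ι ^ 2 * windowError n (α n) K)
            * pairMGF ι (α n ^ 2 / n) ^ n))
        + tupleRemainder n (α n) ε c d * pairMGF ι (α n ^ 2 / n) ^ n := by
        gcongr
        exact le_mul_of_one_le_right (tupleRemainder_nonneg fun s => (hcd s).le) hMGF
    _ = (∏ s, (d s - c s)) * ((1 + δ / 2)
          * Real.exp (3 / 2 * Fintype.card ι ^ 2 * windowError n (α n) K)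
          + tupleRemainder n (α n) ε c d / ∏ s, (d s - c s))
        * pairMGF ι (α n ^ 2 / n) ^ n := by field
    _ ≤ _ := by gcongr

lemma eventually_le_sum_windowProb (hα₀ : ∀ n, 0 ≤ α n)
    (hα : α =o[atTop] fun n : ℕ => √(n : ℝ)) (hc : ∀ s, 0 ≤ c s) (hcd : ∀ s, c s ≤ d s)
    (hG : ∀ n σ, Function.Injective σ → σ ∈ G n) {δ : ℝ} (hδ : 0 < δ) :
    ∀ᶠ n : ℕ in atTop, (∏ s, (d s - c s)) * (1 - δ)
        * (Real.exp (-(4 * (Fintype.card ι : ℝ) ^ 7 * (α n ^ 6 / (n : ℝ) ^ 2)))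
          * pairMGF ι (α n ^ 2 / n) ^ n)
      ≤ ∑ σ ∈ G n, windowProb σ (α n) c d := by
  obtain ⟨K, hK₀, hK⟩ : ∃ K, 0 ≤ K ∧ ∀ s, d s ≤ K :=
    (Finite.exists_le d).elim fun K hK =>
      ⟨max K 0, le_max_right _ _, fun s => le_max_of_le_left (hK s)⟩
  obtain ⟨ε, hε₀, hε, hε₁, hdet⟩ :=
    exists_isNearOrthogonal_threshold ι (lt_min (half_pos hδ) one_pos)
  set δ' := min (δ / 2) 1
  set k : ℝ := (Fintype.card ι : ℝ)
  have hβ := tendsto_sq_div_nat hα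
  have hdefect := tendsto_tiltedDefectBound hα k
  have hlim : Tendsto (fun n : ℕ => (1 - δ')
      * Real.exp (-((3 / 2 * k ^ 2 + k ^ 3) * windowError n (α n) K))
      * ((1 - tiltedDefectBound n (α n) k / ε ^ 2) * Real.exp (-(k ^ 3 * (α n ^ 2 / n)))))
      atTop (𝓝 (1 - δ')) := by
    simpa using ((((tendsto_windowError hα K).const_mul _).neg.rexp).const_mul (1 - δ')).mul
      (((hdefect.div_const (ε ^ 2)).const_sub 1).mul (hβ.const_mul (k ^ 3)).neg.rexp)
  have hδ' : 1 - δ < 1 - δ' := sub_lt_sub_left ((min_le_left _ _).trans_lt (half_lt_self hδ)) _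
  filter_upwards [eventually_gt_atTop 0, hlim.eventually_const_le hδ',
    hdefect.eventually_le_const (by positivity : (0 : ℝ) < ε ^ 2),
    (by simpa using hβ.mul_const (k ^ 2) :
      Tendsto (fun n : ℕ => α n ^ 2 / n * k ^ 2) atTop (𝓝 0)).eventually_le_const one_pos]
    with n hn hfactor hdefectn hβn
  refine le_trans ?_ (le_sum_windowProb hn (hα₀ n) hK₀ hc hcd hK (min_le_right _ _) hε₀ hε
    (fun σ hσ => sub_le_of_abs_sub_le_left (hdet σ hσ)) hβn hdefectn
    fun σ hσ => hG n σ (injective_of_isNearOrthogonal hn hε₁ hσ))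
  have hγ : 0 ≤ ∏ s, (d s - c s) := Finset.prod_nonneg fun s _ => sub_nonneg.mpr (hcd s)
  have hMGF : 0 < pairMGF ι (α n ^ 2 / n) := pairMGF_pos _
  rw [exp_neg_mul_tiltedDefectBound hn]
  calc _ ≤ (∏ s, (d s - c s)) * ((1 - δ')
        * Real.exp (-((3 / 2 * k ^ 2 + k ^ 3) * windowError n (α n) K))
        * ((1 - tiltedDefectBound n (α n) k / ε ^ 2) * Real.exp (-(k ^ 3 * (α n ^ 2 / n)))))
        * (Real.exp (-(4 * k ^ 7 * (α n ^ 6 / (n : ℝ) ^ 2))) * pairMGF ι (α n ^ 2 / n) ^ n) := by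
        gcongr
    _ = _ := by ring

lemma eventually_pairMGF_pow_mem_Icc (ι : Type*) [Fintype ι] [DecidableEq ι]
    (hα : α =o[atTop] fun n : ℕ => √(n : ℝ)) :
    ∀ᶠ n : ℕ in atTop, pairMGF ι (α n ^ 2 / n) ^ n ∈ Set.Icc
      (Real.exp (Fintype.card ι * (Fintype.card ι - 1) / (4 * n) * α n ^ 4
        - 2 * Fintype.card ι ^ 6 * (α n ^ 6 / (n : ℝ) ^ 2)))
      (Real.exp (Fintype.card ι * (Fintype.card ι - 1) / (4 * n) * α n ^ 4
        + Fintype.card ι ^ 6 * (α n ^ 6 / (n : ℝ) ^ 2))) := by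
  set k : ℝ := (Fintype.card ι : ℝ)
  filter_upwards [eventually_gt_atTop 0,
    (by simpa using (tendsto_sq_div_nat hα).mul_const (k ^ 2) :
      Tendsto (fun n : ℕ => α n ^ 2 / n * k ^ 2) atTop (𝓝 0)).eventually_le_const one_half_pos]
    with n hn hβ
  have hpow (x : ℝ) :
      Real.exp (k * (k - 1) / 4 * (α n ^ 2 / n) ^ 2 + x * (α n ^ 2 / n) ^ 3) ^ n
        = Real.exp (k * (k - 1) / (4 * n) * α n ^ 4 + x * (α n ^ 6 / (n : ℝ) ^ 2)) := by
    rw [← Real.exp_nat_mul]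
    congr 1
    field
  constructor
  · rw [sub_eq_add_neg, ← neg_mul, ← hpow]
    gcongr
    rw [neg_mul, ← sub_eq_add_neg]
    exact exp_le_pairMGF (by positivity) hβ
  · rw [← hpow]
    exact pow_le_pow_left₀ (zero_le_one.trans (one_le_pairMGF _))
      (pairMGF_le_exp (by positivity) (hβ.trans (by norm_num))) n

omit [DecidableEq ι] in
lemma exists_sum_windowProb_mem_Icc (hα₀ : ∀ n, 0 ≤ α n)
    (hα : α =o[atTop] fun n : ℕ => √(n : ℝ)) (hc : ∀ s, 0 ≤ c s) (hcd : ∀ s, c s < d s)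
    (hG : ∀ n σ, Function.Injective σ → σ ∈ G n)
    (hG₀ : ∀ n, 0 < n → ∀ σ ∈ G n, ¬ PairwiseNonparallel σ → windowProb σ (α n) c d = 0) :
    ∃ C : ℝ, 0 ≤ C ∧ ∀ δ : ℝ, 0 < δ → ∀ᶠ n : ℕ in atTop,
      ∑ σ ∈ G n, windowProb σ (α n) c d ∈ Set.Icc
        ((∏ s, (d s - c s)) * (1 - δ)
          * Real.exp (Fintype.card ι * (Fintype.card ι - 1) / (4 * n) * α n ^ 4
            - C * (α n ^ 6 / (n : ℝ) ^ 2)))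
        ((∏ s, (d s - c s)) * (1 + δ)
          * Real.exp (Fintype.card ι * (Fintype.card ι - 1) / (4 * n) * α n ^ 4
            + C * (α n ^ 6 / (n : ℝ) ^ 2))) := by
  classical
  set k : ℝ := (Fintype.card ι : ℝ)
  have hγ : 0 ≤ ∏ s, (d s - c s) := Finset.prod_nonneg fun s _ => sub_nonneg.mpr (hcd s).le
  refine ⟨4 * k ^ 7 + 2 * k ^ 6, by positivity, fun δ hδ => ?_⟩
  filter_upwards [eventually_sum_windowProb_le hα₀ hα hc hcd hG₀ hδ,
    eventually_le_sum_windowProb hα₀ hα hc (fun s => (hcd s).le) hG (lt_min hδ one_pos),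
    eventually_pairMGF_pow_mem_Icc ι hα] with n hup hlow hMGF
  constructor
  · refine le_trans ?_ hlow
    have hexp := (mul_le_mul_of_nonneg_left hMGF.1
      (Real.exp_pos (-(4 * k ^ 7 * (α n ^ 6 / (n : ℝ) ^ 2)))).le)
    rw [← Real.exp_add] at hexp
    have hδ' : 0 ≤ 1 - min δ 1 := sub_nonneg.mpr (min_le_right _ _)
    calc _ ≤ (∏ s, (d s - c s)) * (1 - min δ 1)
          * Real.exp (k * (k - 1) / (4 * n) * α n ^ 4
            - (4 * k ^ 7 + 2 * k ^ 6) * (α n ^ 6 / (n : ℝ) ^ 2)) := by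
          gcongr
          exact min_le_left _ _
      _ ≤ _ := by
          gcongr
          exact (Real.exp_le_exp.mpr (le_of_eq (by ring))).trans hexp
  · refine hup.trans ?_
    gcongr
    refine hMGF.2.trans (Real.exp_le_exp.mpr ?_)
    gcongr
    have hk : 0 ≤ k := Nat.cast_nonneg _
    linarith [pow_nonneg hk 6, pow_nonneg hk 7]

end TupleSumAsymptotics

section FirstMoment

lemma overlap_eq_one_of_unique {n : ℕ} {ι : Type*} [Unique ι] (hn : 0 < n) (σ : ι → Spin n) :
    overlap σ = 1 := by
  ext s t
  rw [Subsingleton.elim s t, overlap_self hn, Matrix.one_apply_eq]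

lemma pairSum_eq_zero_of_unique {ι : Type*} [Unique ι] (y : ι → ℤˣ) : pairSum y = 0 := by
  simp [pairSum, coe_units_mul_self, sq]

lemma windowProb_mem_Icc_of_unique {n : ℕ} {ι : Type*} [Unique ι] (hn : 0 < n) (σ : ι → Spin n)
    {α c d : ℝ} (hα : 0 ≤ α) (hc : 0 ≤ c) (hcd : c ≤ d) :
    windowProb σ α (fun _ => c) (fun _ => d) ∈ Set.Icc
      ((d - c) / 2 ^ n * Real.exp (-(5 / 2 * windowError n α d)))
      ((d - c) / 2 ^ n * Real.exp (3 / 2 * windowError n α d)) := by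
  have hov := overlap_eq_one_of_unique hn σ
  have hup := windowProb_le_exp_pairSum hn (hov ▸ Matrix.PosDef.one : (overlap σ).PosDef) hα
    (fun _ => hc) (fun _ => hcd) fun _ => le_rfl
  have hlow := exp_pairSum_sub_overlapDefect_le_windowProb hn (ε := 0)
    (fun s t => by simp [hov] : IsNearOrthogonal 0 σ) (by simp) hα (hc.trans hcd)
    (fun _ => hc) (fun _ => hcd) fun _ => le_rfl
  refine ⟨le_of_eq_of_le ?_ hlow, hup.trans_eq ?_⟩ <;>
    norm_num [overlapDefect, hov, pairSum_eq_zero_of_unique]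

lemma integral_numPoints_mem_Icc {n : ℕ} {Ω : Type*} [MeasurableSpace Ω] {P : Measure Ω}
    {X : Fin n → Ω → ℝ} (hn : 0 < n) (hind : iIndepFun X P)
    (hlaw : ∀ i, HasLaw (X i) (gaussianReal 0 1) P) {α : ℝ} (hα : 0 ≤ α) {c d : ℝ} (hc : 0 ≤ c)
    (hcd : c ≤ d) :
    ∫ ω, (numPoints (fun i => X i ω) (α + c * scaling n α) (α + d * scaling n α) : ℝ) ∂P
      ∈ Set.Icc ((d - c) * Real.exp (-(5 / 2 * windowError n α d)))
        ((d - c) * Real.exp (3 / 2 * windowError n α d)) := by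
  have hmoment := factorialMoment_eq_sum_windowProb (L := Unit) hn hind hlaw hα (fun _ => hc)
    (fun _ => d) fun _ => 1
  have hall : blockInjective (Spin n) (fun _ : Unit => 1) = Finset.univ :=
    Finset.filter_true_of_mem fun σ _ l => Function.injective_of_subsingleton _
  simp only [factorialMoment, Finset.univ_unique, Finset.prod_singleton, Nat.descFactorial_one,
    hall] at hmoment
  have _ : Unique (Σ _ : Unit, Fin 1) := (Equiv.uniqueSigma _).unique
  have hcard : Fintype.card ((Σ _ : Unit, Fin 1) → Spin n) = 2 ^ n := by simp
  have hmem (σ : (Σ _ : Unit, Fin 1) → Spin n) := windowProb_mem_Icc_of_unique hn σ hα hc hcd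
  have hcancel (x : ℝ) : 2 ^ n • ((d - c) / 2 ^ n * x) = (d - c) * x := by
    rw [nsmul_eq_mul]
    push_cast
    field
  rw [hmoment, ← hcancel, ← hcancel, ← hcard, ← Finset.card_univ]
  exact ⟨Finset.card_nsmul_le_sum _ _ _ fun σ _ => (hmem σ).1,
    Finset.sum_le_card_nsmul _ _ _ fun σ _ => (hmem σ).2⟩

lemma tendsto_integral_numPoints {Ω : ℕ → Type*} [∀ n, MeasurableSpace (Ω n)]
    {P : ∀ n, Measure (Ω n)} {X : ∀ n, Fin n → Ω n → ℝ} {α : ℕ → ℝ}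
    (hind : ∀ n, iIndepFun (X n) (P n))
    (hlaw : ∀ n i, HasLaw (X n i) (gaussianReal 0 1) (P n)) (hα₀ : ∀ n, 0 ≤ α n)
    (hα : α =o[atTop] fun n : ℕ => √(n : ℝ)) {c d : ℝ} (hc : 0 ≤ c) (hcd : c ≤ d) :
    Tendsto (fun n => ∫ ω, (numPoints (fun i => X n i ω) (α n + c * scaling n (α n))
      (α n + d * scaling n (α n)) : ℝ) ∂P n) atTop (𝓝 (d - c)) := by
  have hlim (r : ℝ) : Tendsto (fun n => (d - c) * Real.exp (r * windowError n (α n) d)) atTop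
      (𝓝 (d - c)) := by
    simpa using (((tendsto_windowError hα d).const_mul r).rexp).const_mul (d - c)
  have hmem : ∀ᶠ n in atTop, _ := (eventually_gt_atTop 0).mono fun n hn =>
    integral_numPoints_mem_Icc hn (hind n) (hlaw n) (hα₀ n) hc hcd
  exact tendsto_of_tendsto_of_tendsto_of_le_of_le' (by simpa only [neg_mul] using hlim (-(5 / 2)))
    (hlim (3 / 2)) (hmem.mono fun _ h => h.1) (hmem.mono fun _ h => h.2)

end FirstMoment

section ExponentialError

lemma abs_sub_max_min_le {x B t : ℝ} (hB : 0 ≤ B) (ht : 0 ≤ t) (h : |x| ≤ B + t) :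
    |x - max (-B) (min B x)| ≤ t := by
  obtain ⟨h₁, h₂⟩ := abs_le.mp h
  grind

lemma exists_add_of_abs_le {R w : ℕ → ℝ} {C : ℝ} (hC : 0 ≤ C) (hw : ∀ n, 0 ≤ w n)
    (h : ∀ t : ℝ, 0 < t → ∀ᶠ n in atTop, |R n| ≤ C * w n + t) :
    ∃ u v : ℕ → ℝ, (u =O[atTop] w) ∧ Tendsto v atTop (𝓝 0) ∧ ∀ n, R n = u n + v n := by
  have hCw (n : ℕ) : 0 ≤ C * w n := mul_nonneg hC (hw n)
  refine ⟨fun n => max (-(C * w n)) (min (C * w n) (R n)),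
    fun n => R n - max (-(C * w n)) (min (C * w n) (R n)), ?_, ?_, fun n => by ring⟩
  · refine IsBigO.of_bound C (Eventually.of_forall fun n => ?_)
    rw [Real.norm_eq_abs, Real.norm_of_nonneg (hw n), abs_le]
    exact ⟨le_max_left _ _, max_le (neg_le_self (hCw n)) (min_le_left _ _)⟩
  · refine Metric.tendsto_nhds.mpr fun t ht => (h (t / 2) (half_pos ht)).mono fun n hn => ?_
    rw [Real.dist_eq, sub_zero]
    exact (abs_sub_max_min_le (hCw n) (half_pos ht).le hn).trans_lt (half_lt_self ht)

lemma neg_two_mul_le_log_one_sub {δ : ℝ} (hδ₀ : 0 ≤ δ) (hδ : δ ≤ 1 / 2) :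
    -(2 * δ) ≤ Real.log (1 - δ) := by
  refine le_trans ?_ (Real.one_sub_inv_le_log_of_pos (by linarith : 0 < 1 - δ))
  rw [neg_le_sub_iff_le_add, inv_le_iff_one_le_mul₀ (by linarith)]
  nlinarith

lemma abs_log_sub_le {y A B δ : ℝ} (hδ₀ : 0 ≤ δ) (hδ : δ ≤ 1 / 2)
    (hy : y ∈ Set.Icc ((1 - δ) * Real.exp (A - B)) ((1 + δ) * Real.exp (A + B))) :
    |Real.log y - A| ≤ B + 2 * δ := by
  have hsub : 0 < 1 - δ := by linarith
  have hadd : 0 < 1 + δ := by linarith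
  have hlow := Real.log_le_log (by positivity) hy.1
  have hup := Real.log_le_log ((by positivity : 0 < (1 - δ) * Real.exp (A - B)).trans_le hy.1) hy.2
  rw [Real.log_mul hsub.ne' (Real.exp_pos _).ne', Real.log_exp] at hlow
  rw [Real.log_mul hadd.ne' (Real.exp_pos _).ne', Real.log_exp] at hup
  rw [abs_le]
  constructor <;> linarith [neg_two_mul_le_log_one_sub hδ₀ hδ, Real.log_le_sub_one_of_pos hadd]

lemma exists_exp_error {L A w : ℕ → ℝ} {γ C : ℝ} (hγ : 0 < γ) (hC : 0 ≤ C) (hw : ∀ n, 0 ≤ w n)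
    (h : ∀ δ : ℝ, 0 < δ → ∀ᶠ n in atTop, L n ∈ Set.Icc
      (γ * (1 - δ) * Real.exp (A n - C * w n)) (γ * (1 + δ) * Real.exp (A n + C * w n))) :
    ∃ u v : ℕ → ℝ, (u =O[atTop] w) ∧ Tendsto v atTop (𝓝 0) ∧
      ∀ᶠ n in atTop, L n = γ * Real.exp (A n) * Real.exp (u n + v n) := by
  have hlog : ∀ t : ℝ, 0 < t → ∀ᶠ n in atTop, |Real.log (L n / γ) - A n| ≤ C * w n + t := by
    intro t ht
    have hδ : 0 < min (t / 2) (1 / 2) := by positivity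
    filter_upwards [h _ hδ] with n hn
    have hdiv : L n / γ ∈ Set.Icc ((1 - min (t / 2) (1 / 2)) * Real.exp (A n - C * w n))
        ((1 + min (t / 2) (1 / 2)) * Real.exp (A n + C * w n)) := by
      rwa [Set.mem_Icc, le_div_iff₀' hγ, div_le_iff₀' hγ, ← mul_assoc, ← mul_assoc]
    linarith [abs_log_sub_le hδ.le (min_le_right _ _) hdiv, min_le_left (t / 2) (1 / 2)]
  obtain ⟨u, v, hu, hv, huv⟩ := exists_add_of_abs_le hC hw hlog
  refine ⟨u, v, hu, hv, ?_⟩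
  filter_upwards [h (1 / 2) one_half_pos] with n hn
  have hpos : 0 < L n :=
    (mul_pos (mul_pos hγ (by norm_num)) (Real.exp_pos _)).trans_le hn.1
  rw [← huv n, mul_assoc, ← Real.exp_add, add_sub_cancel, Real.exp_log (div_pos hpos hγ),
    mul_div_cancel₀ _ hγ.ne']

end ExponentialError

section LowerBound

variable {α L : ℕ → ℝ} {γ C κ : ℝ}

lemma exists_pos_le_pow_four_div
    (hα4 : (fun n : ℕ => (n : ℝ) ^ (1 / 4 : ℝ)) =O[atTop] α) :
    ∃ b : ℝ, 0 < b ∧ ∀ᶠ n : ℕ in atTop, b ≤ α n ^ 4 / n := by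
  obtain ⟨c, hc, hbound⟩ := hα4.exists_pos
  refine ⟨(c ^ 4)⁻¹, by positivity, ?_⟩
  filter_upwards [hbound.bound, eventually_gt_atTop 0] with n hn hn₀
  have hpow := pow_le_pow_left₀ (norm_nonneg _) hn 4
  rw [Real.norm_of_nonneg (by positivity), mul_pow, Real.norm_eq_abs,
    Even.pow_abs (by decide : Even 4), ← Real.rpow_mul_natCast (Nat.cast_nonneg n),
    (by norm_num : (1 / 4 : ℝ) * (4 : ℕ) = 1), Real.rpow_one] at hpow
  rwa [le_div_iff₀ (by positivity), inv_mul_le_iff₀ (by positivity)]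

lemma exists_pos_le_exponent (hκ : 0 < κ) (hα : α =o[atTop] fun n : ℕ => √(n : ℝ))
    (hα4 : (fun n : ℕ => (n : ℝ) ^ (1 / 4 : ℝ)) =O[atTop] α) (C : ℝ) :
    ∃ q : ℝ, 0 < q ∧ ∀ᶠ n : ℕ in atTop,
      q ≤ κ / n * α n ^ 4 - C * (α n ^ 6 / (n : ℝ) ^ 2) := by
  obtain ⟨b, hb, hpow⟩ := exists_pos_le_pow_four_div hα4
  have hlim : Tendsto (fun n : ℕ => C * (α n ^ 2 / n)) atTop (𝓝 0) := by
    simpa using (tendsto_sq_div_nat hα).const_mul C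
  refine ⟨κ / 2 * b, by positivity, ?_⟩
  filter_upwards [hpow, hlim.eventually_le_const (half_pos hκ), eventually_gt_atTop 0]
    with n hn hsmall hn₀
  calc κ / 2 * b ≤ (κ - C * (α n ^ 2 / n)) * (α n ^ 4 / n) :=
        mul_le_mul (by linarith) hn hb.le (by linarith)
    _ = _ := by field

lemma exists_one_add_mul_le (hγ : 0 < γ) (hκ : 0 < κ)
    (hα : α =o[atTop] fun n : ℕ => √(n : ℝ))
    (hα4 : (fun n : ℕ => (n : ℝ) ^ (1 / 4 : ℝ)) =O[atTop] α)
    (h : ∀ δ : ℝ, 0 < δ → ∀ᶠ n : ℕ in atTop,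
      γ * (1 - δ) * Real.exp (κ / n * α n ^ 4 - C * (α n ^ 6 / (n : ℝ) ^ 2)) ≤ L n) :
    ∃ q : ℝ, 0 < q ∧ ∀ᶠ n in atTop, (1 + q) * γ ≤ L n := by
  obtain ⟨q, hq, hexponent⟩ := exists_pos_le_exponent hκ hα hα4 C
  refine ⟨q / 2, half_pos hq, ?_⟩
  have hδ : 1 - q / (2 * (1 + q)) = (1 + q / 2) / (1 + q) := by field
  filter_upwards [h (q / (2 * (1 + q))) (by positivity), hexponent] with n hn hqn
  calc (1 + q / 2) * γ = γ * (1 - q / (2 * (1 + q))) * (1 + q) := by rw [hδ]; field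
    _ ≤ γ * (1 - q / (2 * (1 + q)))
        * Real.exp (κ / n * α n ^ 4 - C * (α n ^ 6 / (n : ℝ) ^ 2)) := by
      rw [hδ]
      gcongr
      linarith [Real.add_one_le_exp (κ / n * α n ^ 4 - C * (α n ^ 6 / (n : ℝ) ^ 2))]
    _ ≤ L n := hn

end LowerBound

section FactorialMoments

variable {Ω : ℕ → Type*} [∀ n, MeasurableSpace (Ω n)] {P : ∀ n, Measure (Ω n)}
  {X : ∀ n, Fin n → Ω n → ℝ} {α : ℕ → ℝ} {L : Type*} [Fintype L]
  {c d : L → ℝ}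

lemma tendsto_prod_integral_numPoints (hind : ∀ n, iIndepFun (X n) (P n))
    (hlaw : ∀ n i, HasLaw (X n i) (gaussianReal 0 1) (P n)) (hα₀ : ∀ n, 0 ≤ α n)
    (hα : α =o[atTop] fun n : ℕ => √(n : ℝ)) (hc : ∀ l, 0 ≤ c l) (hcd : ∀ l, c l ≤ d l)
    (k : L → ℕ) :
    Tendsto (fun n => ∏ l, (∫ ω, (numPoints (fun i => X n i ω) (α n + c l * scaling n (α n))
      (α n + d l * scaling n (α n)) : ℝ) ∂P n) ^ k l) atTop (𝓝 (∏ l, (d l - c l) ^ k l)) :=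
  tendsto_finsetProd Finset.univ fun l _ =>
    (tendsto_integral_numPoints hind hlaw hα₀ hα (hc l) (hcd l)).pow (k l)

lemma exists_factorialMoment_mem_Icc (hind : ∀ n, iIndepFun (X n) (P n))
    (hlaw : ∀ n i, HasLaw (X n i) (gaussianReal 0 1) (P n)) (hα₀ : ∀ n, 0 ≤ α n)
    (hα : α =o[atTop] fun n : ℕ => √(n : ℝ)) (hc : ∀ l, 0 ≤ c l) (hcd : ∀ l, c l < d l)
    (hdisj : Pairwise fun l l' => Disjoint (Set.Ioo (c l) (d l)) (Set.Ioo (c l') (d l')))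
    (k : L → ℕ) :
    ∃ C : ℝ, 0 ≤ C ∧ ∀ δ : ℝ, 0 < δ → ∀ᶠ n : ℕ in atTop,
      factorialMoment (P n) (X n) (α n) c d k ∈ Set.Icc
        ((∏ l, (d l - c l) ^ k l) * (1 - δ)
          * Real.exp (((∑ l, k l : ℕ) : ℝ) * (((∑ l, k l : ℕ) : ℝ) - 1) / (4 * n) * α n ^ 4
            - C * (α n ^ 6 / (n : ℝ) ^ 2)))
        ((∏ l, (d l - c l) ^ k l) * (1 + δ)
          * Real.exp (((∑ l, k l : ℕ) : ℝ) * (((∑ l, k l : ℕ) : ℝ) - 1) / (4 * n) * α n ^ 4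
            + C * (α n ^ 6 / (n : ℝ) ^ 2))) := by
  classical
  obtain ⟨C, hC, h⟩ := exists_sum_windowProb_mem_Icc (ι := Σ l, Fin (k l))
    (G := fun n => blockInjective (Spin n) k) hα₀ hα (fun s => hc s.1) (fun s => hcd s.1)
    (fun n σ hσ => Finset.mem_filter_univ _ |>.mpr fun l => hσ.comp sigma_mk_injective)
    fun n hn σ => windowProb_eq_zero_of_not_pairwiseNonparallel hn (hα₀ n) hc hdisj
  have hcard : Fintype.card (Σ l, Fin (k l)) = ∑ l, k l := by simp
  have hprod : ∏ s : Σ l, Fin (k l), (d s.1 - c s.1) = ∏ l, (d l - c l) ^ k l := by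
    simp [Fintype.prod_sigma]
  rw [hcard, hprod] at h
  refine ⟨C, hC, fun δ hδ => ?_⟩
  filter_upwards [h δ hδ, eventually_gt_atTop 0] with n hn hn₀
  rwa [factorialMoment_eq_sum_windowProb hn₀ (hind n) (hlaw n) (hα₀ n) hc]

lemma exists_factorialMoment_eq (hind : ∀ n, iIndepFun (X n) (P n))
    (hlaw : ∀ n i, HasLaw (X n i) (gaussianReal 0 1) (P n)) (hα₀ : ∀ n, 0 ≤ α n)
    (hα : α =o[atTop] fun n : ℕ => √(n : ℝ)) (hc : ∀ l, 0 ≤ c l) (hcd : ∀ l, c l < d l)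
    (hdisj : Pairwise fun l l' => Disjoint (Set.Ioo (c l) (d l)) (Set.Ioo (c l') (d l')))
    (k : L → ℕ) :
    ∃ u v : ℕ → ℝ, (u =O[atTop] fun n : ℕ => α n ^ 6 / (n : ℝ) ^ 2) ∧ Tendsto v atTop (𝓝 0) ∧
      ∀ᶠ n : ℕ in atTop, factorialMoment (P n) (X n) (α n) c d k
        = (∏ l, (d l - c l) ^ k l)
          * Real.exp (((∑ l, k l : ℕ) : ℝ) * (((∑ l, k l : ℕ) : ℝ) - 1) / (4 * n) * α n ^ 4)
          * Real.exp (u n + v n) := by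
  obtain ⟨C, hC, h⟩ := exists_factorialMoment_mem_Icc hind hlaw hα₀ hα hc hcd hdisj k
  have hγ : 0 < ∏ l, (d l - c l) ^ k l :=
    Finset.prod_pos fun l _ => pow_pos (sub_pos.mpr (hcd l)) _
  exact exists_exp_error hγ hC (fun n => div_nonneg (pow_nonneg (hα₀ n) 6) (sq_nonneg _)) h

lemma exists_one_add_mul_prod_le_factorialMoment (hind : ∀ n, iIndepFun (X n) (P n))
    (hlaw : ∀ n i, HasLaw (X n i) (gaussianReal 0 1) (P n)) (hα₀ : ∀ n, 0 ≤ α n)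
    (hα : α =o[atTop] fun n : ℕ => √(n : ℝ))
    (hα4 : (fun n : ℕ => (n : ℝ) ^ (1 / 4 : ℝ)) =O[atTop] α)
    (hc : ∀ l, 0 ≤ c l) (hcd : ∀ l, c l < d l)
    (hdisj : Pairwise fun l l' => Disjoint (Set.Ioo (c l) (d l)) (Set.Ioo (c l') (d l')))
    {k : L → ℕ} (hk : 2 ≤ ∑ l, k l) :
    ∃ q : ℝ, 0 < q ∧ ∀ᶠ n : ℕ in atTop,
      (1 + q) * ∏ l, (d l - c l) ^ k l ≤ factorialMoment (P n) (X n) (α n) c d k := by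
  obtain ⟨C, -, h⟩ := exists_factorialMoment_mem_Icc hind hlaw hα₀ hα hc hcd hdisj k
  have hk₂ : (2 : ℝ) ≤ ((∑ l, k l : ℕ) : ℝ) := by exact_mod_cast hk
  refine exists_one_add_mul_le (C := C) (Finset.prod_pos fun l _ => pow_pos (sub_pos.mpr (hcd l)) _)
    (div_pos (mul_pos (by linarith) (by linarith)) four_pos :
      0 < ((∑ l, k l : ℕ) : ℝ) * (((∑ l, k l : ℕ) : ℝ) - 1) / 4) hα hα4 fun δ hδ => ?_
  filter_upwards [h δ hδ] with n hn
  rw [div_div]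
  exact hn.1

end FactorialMoments

end NumberPartitioning

theorem theorem3p3
    {Ω : ℕ → Type*} [∀ n, MeasurableSpace (Ω n)]
    (P : ∀ n, Measure (Ω n)) [∀ n, IsProbabilityMeasure (P n)]
    (X : ∀ n, Fin n → Ω n → ℝ)
    (hind : ∀ n, iIndepFun (X n) (P n))
    (hlaw : ∀ n i, HasLaw (X n i) (gaussianReal 0 1) (P n))
    (α : ℕ → ℝ) (hα_nonneg : ∀ n, 0 ≤ α n)
    (hα : α =o[atTop] fun n : ℕ => √(n : ℝ)) :
    -- (i) the first moment
    (∀ t : ℝ, 0 < t →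
      Tendsto
        (fun n : ℕ => ∫ ω, (NumberPartitioning.numPoints (fun i => X n i ω)
          (α n) (α n + t * NumberPartitioning.scaling n (α n)) : ℝ) ∂(P n))
        atTop (𝓝 t)) ∧
    -- (ii) the mixed factorial moments
    (∀ (m : ℕ) (c d : Fin m → ℝ) (k : Fin m → ℕ),
      (∀ l, 0 ≤ c l) → (∀ l, c l < d l) →
      (Pairwise fun l l' => Disjoint (Set.Ioo (c l) (d l)) (Set.Ioo (c l') (d l'))) →
      (∀ l, 0 < k l) → 2 ≤ ∑ l, k l →
      ∃ u v : ℕ → ℝ,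
        (u =O[atTop] fun n : ℕ => α n ^ 6 / (n : ℝ) ^ 2) ∧
        Tendsto v atTop (𝓝 0) ∧
        ∀ᶠ n : ℕ in atTop,
          ∫ ω, ∏ l, ((NumberPartitioning.numPoints (fun i => X n i ω)
              (α n + c l * NumberPartitioning.scaling n (α n))
              (α n + d l * NumberPartitioning.scaling n (α n))).descFactorial (k l) : ℝ) ∂(P n)
            = (∏ l, (d l - c l) ^ k l)
              * Real.exp (((∑ l, k l : ℕ) : ℝ) * (((∑ l, k l : ℕ) : ℝ) - 1) / (4 * (n : ℝ))
                  * α n ^ 4)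
              * Real.exp (u n + v n)) ∧
    -- (iii) the factorization fails once `α n` is of order `n ^ (1 / 4)`
    (((fun n : ℕ => (n : ℝ) ^ (1 / 4 : ℝ)) =O[atTop] α) →
      ∀ (m : ℕ) (c d : Fin m → ℝ) (k : Fin m → ℕ),
      (∀ l, 0 ≤ c l) → (∀ l, c l < d l) →
      (Pairwise fun l l' => Disjoint (Set.Ioo (c l) (d l)) (Set.Ioo (c l') (d l'))) →
      (∀ l, 0 < k l) → 2 ≤ ∑ l, k l →
      ∃ δ : ℝ, 0 < δ ∧ ∀ᶠ n : ℕ in atTop,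
        (1 + δ) * ∏ l, (d l - c l) ^ k l
          ≤ ∫ ω, ∏ l, ((NumberPartitioning.numPoints (fun i => X n i ω)
              (α n + c l * NumberPartitioning.scaling n (α n))
              (α n + d l * NumberPartitioning.scaling n (α n))).descFactorial (k l) : ℝ) ∂(P n) ∧
        (1 + δ) * ∏ l, (∫ ω, (NumberPartitioning.numPoints (fun i => X n i ω)
              (α n + c l * NumberPartitioning.scaling n (α n))
              (α n + d l * NumberPartitioning.scaling n (α n)) : ℝ) ∂(P n)) ^ k l
          ≤ ∫ ω, ∏ l, ((NumberPartitioning.numPoints (fun i => X n i ω)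
              (α n + c l * NumberPartitioning.scaling n (α n))
              (α n + d l * NumberPartitioning.scaling n (α n))).descFactorial (k l) : ℝ) ∂(P n))
  := by
  refine ⟨fun t ht => ?_, fun m c d k hc hcd hdisj _ _ => ?_,
    fun hα4 m c d k hc hcd hdisj _ hk => ?_⟩
  · simpa using NumberPartitioning.tendsto_integral_numPoints hind hlaw hα_nonneg hα le_rfl ht.le
  · exact NumberPartitioning.exists_factorialMoment_eq hind hlaw hα_nonneg hα hc hcd hdisj k
  · obtain ⟨q, hq, hmoment⟩ := NumberPartitioning.exists_one_add_mul_prod_le_factorialMoment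
      hind hlaw hα_nonneg hα hα4 hc hcd hdisj hk
    have hγ : 0 < ∏ l, (d l - c l) ^ k l :=
      Finset.prod_pos fun l _ => pow_pos (sub_pos.mpr (hcd l)) _
    have hprod := (NumberPartitioning.tendsto_prod_integral_numPoints hind hlaw hα_nonneg hα hc
      (fun l => (hcd l).le) k).const_mul (1 + q / 2)
    have hlt : 1 + q / 2 < 1 + q := add_lt_add_right (half_lt_self hq) 1
    refine ⟨q / 2, half_pos hq, ?_⟩
    filter_upwards [hmoment, hprod.eventually_le_const (mul_lt_mul_of_pos_right hlt hγ)]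
      with n hn hprodn
    exact ⟨(mul_le_mul_of_nonneg_right hlt.le hγ.le).trans hn, hprodn.trans hn⟩
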